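/- **Lemma (Local Lipschitz property of the primal and dual error indicators).** Let $d\in\{2,3\}$, $n\ge 0$ and $\sigma\in\mathbb R$. There is a constant $\bar\Lambda_1>0$, depending only on $d$, the polynomial degree $n$ and $\sigma$, such that the following holds. *Setting.* Let $\Omega\subset\mathbb R^d$ be open with a conforming triangulation $\mathcal T_0$ into finitely many closed simplices which is shape regular with constant $\sigma$, i.e. $\operatorname{diam}T\le\sigma h_T$ for $T\in\mathcal T_0$, where $h_T=|T|^{1/d}$. Let $\mathcal T$ be a conforming refinement of $\mathcal T_0$ obtained by newest vertex bisection (for any fixed initial tagging of $\mathcal T_0$). For a triangulation $\mathcal T$ put $\mathbb V_{\mathcal T}=H^1_0(\Omega)\cap\prod_{T\in\mathcal T}\mathbb P_n(T)$. Let $A:\Omega\to\mathbb R^{d\times d}$ be Lipschitz, symmetric, with eigenvalues in $[\mu_0,\mu_1]$, $0<\mu_0\le\mu_1<\infty$; let $b:\Omega\times\mathbb R\to\mathbb R$ be measurable in the first and smooth in the second argument, with $b'=\partial_\xi b\ge0$; let $f,g\in L_2(\Omega)$. Let $u\in H^1_0(\Omega)$ satisfy $\int_\Omega A\nabla u\cdot\nabla\varphi+\int_\Omega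 b(u)\varphi=\int_\Omega f\varphi$ for all $\varphi\in H^1_0(\Omega)$, where $b(u)(x)=b(x,u(x))$, and let $u_-,u_+\in L_\infty(\Omega)$ with $u_-\le u\le u_+$ a.e. Let $B\ge0$ be such that for a.e. $x\in\Omega$ the function $b(x,\cdot)$ is Lipschitz on $[u_-(x),u_+(x)]$ with constant $B$. *Notation.* For $T\in\mathcal T$ let $\omega_T$ be the union of $T$ and all $T'\in\mathcal T$ such that $T\cap T'$ is a $(d-1)$-dimensional face of $T$, and $$\eta_{\mathcal T}(\mathbf D,T)=h_T\Bigl(\|\operatorname{div}A\|_{L_\infty(T)}^2+h_T^{-2}\|A\|_{L_\infty(\omega_T)}^2+B^2\Bigr)^{1/2}.$$ For $v\in\mathbb V_{\mathcal T}$ let $J_T(v)$ be the jump of $A\nabla v\cdot n$ across $\partial T\cap\Omega$ ($J_T(v)=0$ on $\partial T\cap\partial\Omega$) and $$\eta_{\mathcal T}^2(v,T)=h_T^2\|f+\nabla\cdot(A\nabla v)-b(v)\|_{L_2(T)}^2+h_T\|J_T(v)\|^2_{L_2(\partial T)},$$ $$\zeta_{\mathcal T}^2(v,T)=h_T^2\|g+\nabla\cdot(A\nabla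 v)-b'(u)v\|_{L_2(T)}^2+h_T\|J_T(v)\|^2_{L_2(\partial T)},$$ and let $\zeta_{\mathcal T,j}(v,T)$ be defined as $\zeta_{\mathcal T}(v,T)$ with $b'(u_j)$ in place of $b'(u)$, where $u_j\in\mathbb V_{\mathcal T_j}$ is a Galerkin solution, $\int_\Omega A\nabla u_j\cdot\nabla\varphi+\int_\Omega b(u_j)\varphi=\int_\Omega f\varphi$ for all $\varphi\in\mathbb V_{\mathcal T_j}$, on a conforming bisection refinement $\mathcal T_j$ of $\mathcal T_0$ (same tagging), with $u_-\le u_j\le u_+$ a.e. *Claim.* For all $T\in\mathcal T$ and $v,w\in\mathbb V_{\mathcal T}$: 1. if $u_-\le v,w\le u_+$ a.e. on $T$, then $|\eta_{\mathcal T}(v,T)-\eta_{\mathcal T}(w,T)|\le\bar\Lambda_1\,\eta_{\mathcal T}(\mathbf D,T)\,\|v-w\|_{H^1(\omega_T)}$ (if $b(v)\notin L_2(T)$ then both indicators are infinite and nothing is claimed beyond this); 2. if $u_-<u_+$ a.e. in $\Omega$, then $|\zeta_{\mathcal T,j}(v,T)-\zeta_{\mathcal T,j}(w,T)|\le\bar\Lambda_1\,\eta_{\mathcal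 T}(\mathbf D,T)\,\|v-w\|_{H^1(\omega_T)}$ and $|\zeta_{\mathcal T}(v,T)-\zeta_{\mathcal T}(w,T)|\le\bar\Lambda_1\,\eta_{\mathcal T}(\mathbf D,T)\,\|v-w\|_{H^1(\omega_T)}$. -/

import Mathlib

open MeasureTheory Filter Topology
open scoped ENNReal NNReal ContDiff

noncomputable section

namespace Goafem

/-- Euclidean space `ℝᵈ`. -/
abbrev E (d : ℕ) := EuclideanSpace ℝ (Fin d)

/-- A nondegenerate `d`-simplex in `ℝᵈ`, with an ordering of its vertices. -/
abbrev Elem (d : ℕ) := Affine.Simplex ℝ (E d) d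

/-! ### Sobolev space, problem data, weak solutions -/

/-- `v` belongs to `H¹₀(Ω)` and `G` is its weak gradient: `(v, G)` is a limit in `L²(Ω)` of
`(φ, ∇φ)` with `φ ∈ C_c^∞(Ω)`. -/
def IsH10 {d : ℕ} (Ω : Set (E d)) (v : E d → ℝ) (G : E d → E d) : Prop :=
  MemLp v 2 (volume.restrict Ω) ∧ MemLp G 2 (volume.restrict Ω) ∧
  ∃ φ : ℕ → E d → ℝ,
    (∀ k, ContDiff ℝ ∞ (φ k) ∧ HasCompactSupport (φ k) ∧ tsupport (φ k) ⊆ Ω) ∧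
    Tendsto (fun k => eLpNorm (fun x => φ k x - v x) 2 (volume.restrict Ω)) atTop (𝓝 0) ∧
    Tendsto (fun k => eLpNorm (fun x => gradient (φ k) x - G x) 2 (volume.restrict Ω))
      atTop (𝓝 0)

/-- The data `A`, `b`, `f` of the problem `-∇·(A∇u) + b(u) = f`. Matrices are identified with
linear endomorphisms of Euclidean space. Only the values on `Ω` matter. -/
structure ProblemData (d : ℕ) where
  A : E d → (E d →L[ℝ] E d)
  b : E d → ℝ → ℝ
  f : E d → ℝ

/-- Assumptions on the problem data: `A` is Lipschitz, symmetric and uniformly positive definite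
and bounded on `Ω`; `b` is measurable in the first argument, smooth and nondecreasing in the
second; `f ∈ L²(Ω)`. -/
structure ProblemData.Admissible {d : ℕ} (D : ProblemData d) (Ω : Set (E d)) : Prop where
  lipschitz : ∃ L : ℝ≥0, LipschitzOnWith L D.A Ω
  symm : ∀ x ∈ Ω, ∀ ξ η : E d, inner ℝ (D.A x ξ) η = inner ℝ ξ (D.A x η)
  elliptic : ∃ μ₀ μ₁ : ℝ, 0 < μ₀ ∧ ∀ x ∈ Ω, ∀ ξ : E d,
    μ₀ * ‖ξ‖ ^ 2 ≤ inner ℝ (D.A x ξ) ξ ∧ inner ℝ (D.A x ξ) ξ ≤ μ₁ * ‖ξ‖ ^ 2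
  measurable_b : ∀ s : ℝ, AEMeasurable (fun x => D.b x s) (volume.restrict Ω)
  smooth_b : ∀ x ∈ Ω, ContDiff ℝ ∞ (D.b x)
  monotone_b : ∀ x ∈ Ω, ∀ s : ℝ, 0 ≤ deriv (D.b x) s
  f_memLp : MemLp D.f 2 (volume.restrict Ω)

/-- `u ∈ H¹₀(Ω)` is a weak solution of `-∇·(A∇u) + b(u) = f`, `u = 0` on `∂Ω`. -/
def IsWeakSolution {d : ℕ} (Ω : Set (E d)) (D : ProblemData d) (u : E d → ℝ) : Prop :=
  ∃ Du : E d → E d, IsH10 Ω u Du ∧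
    ∀ (φ : E d → ℝ) (Dφ : E d → E d), IsH10 Ω φ Dφ →
      IntegrableOn (fun x => D.b x (u x) * φ x) Ω ∧
      (∫ x in Ω, inner ℝ (D.A x (Du x)) (Dφ x)) + (∫ x in Ω, D.b x (u x) * φ x)
        = ∫ x in Ω, D.f x * φ x

/-! ### Conforming triangulations -/

/-- A conforming triangulation of `Ω` into finitely many closed simplices: the open simplices lie
in `Ω`, the closed ones cover the closure of `Ω`, and two distinct simplices (which do not have
the same vertex set) meet exactly in the convex hull of their common vertices. -/
structure Triangulation (d : ℕ) (Ω : Set (E d)) where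
  elems : Finset (Elem d)
  interior_subset : ∀ T ∈ elems, T.interior ⊆ Ω
  cover : ⋃ T ∈ elems, T.closedInterior = closure Ω
  vertices_ne : ∀ S ∈ elems, ∀ T ∈ elems, S ≠ T → Set.range S.points ≠ Set.range T.points
  conforming : ∀ S ∈ elems, ∀ T ∈ elems, S ≠ T →
    S.closedInterior ∩ T.closedInterior =
      convexHull ℝ (Set.range S.points ∩ Set.range T.points)

/-- The element size `h_T = |T|^{1/d}`. -/
def meshSize {d : ℕ} (T : Elem d) : ℝ :=
  (volume.real T.closedInterior) ^ (1 / (d : ℝ))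

/-- Shape regularity with constant `σ`: `diam T ≤ σ h_T` for all elements. -/
def Triangulation.ShapeRegular {d : ℕ} {Ω : Set (E d)} (𝒯 : Triangulation d Ω) (σ : ℝ) : Prop :=
  ∀ T ∈ 𝒯.elems, Metric.diam T.closedInterior ≤ σ * meshSize T

/-! ### Refinement by newest vertex bisection

A tagged simplex is an ordered vertex tuple `(y₀, …, y_d)` together with a type `γ ∈ {0, …, d-1}`.
Its refinement edge is `y₀ y_d`, with midpoint `m`; its children are
`(y₀, m, y₁, …, y_γ, y_{γ+1}, …, y_{d-1})` and `(y_d, m, y₁, …, y_γ, y_{d-1}, …, y_{γ+1})`, both of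
type `γ + 1 mod d`. For `d = 2` the refinement edge of a child is opposite to the new vertex. -/

/-- The child `(y₀, m, y₁, …, y_{d-1})`. -/
def bisectFst {d : ℕ} (y : Fin (d + 1) → E d) : Fin (d + 1) → E d := fun i =>
  if (i : ℕ) = 0 then y 0
  else if (i : ℕ) = 1 then midpoint ℝ (y 0) (y (Fin.last d))
  else y (Fin.ofNat (d + 1) (i - 1))

/-- The child `(y_d, m, y₁, …, y_γ, y_{d-1}, …, y_{γ+1})`. -/
def bisectSnd {d : ℕ} (y : Fin (d + 1) → E d) (γ : Fin d) : Fin (d + 1) → E d := fun i =>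
  if (i : ℕ) = 0 then y (Fin.last d)
  else if (i : ℕ) = 1 then midpoint ℝ (y 0) (y (Fin.last d))
  else if (i : ℕ) ≤ (γ : ℕ) + 1 then y (Fin.ofNat (d + 1) (i - 1))
  else y (Fin.ofNat (d + 1) (d + (γ : ℕ) + 1 - i))

/-- `Descends x γ y δ`: the tagged simplex `(y, δ)` arises from `(x, γ)` by finitely many
bisections. -/
inductive Descends {d : ℕ} [NeZero d] (x : Fin (d + 1) → E d) (γ : Fin d) :
    (Fin (d + 1) → E d) → Fin d → Prop
  | refl : Descends x γ x γ
  | fst {y : Fin (d + 1) → E d} {δ : Fin d} :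
      Descends x γ y δ → Descends x γ (bisectFst y) (δ + 1)
  | snd {y : Fin (d + 1) → E d} {δ : Fin d} :
      Descends x γ y δ → Descends x γ (bisectSnd y δ) (δ + 1)

/-- `𝒯` is a conforming refinement of `𝒯₀` by newest vertex bisection, the elements of `𝒯₀` being
tagged by their vertex order and the types `τ`: each element of `𝒯` arises from an element of `𝒯₀`
by bisections (as a geometric simplex, i.e. up to the order of its vertices). -/
def Triangulation.IsRefinement {d : ℕ} [NeZero d] {Ω : Set (E d)} (𝒯 𝒯₀ : Triangulation d Ω)
    (τ : Elem d → Fin d) : Prop :=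
  ∀ T ∈ 𝒯.elems, ∃ S ∈ 𝒯₀.elems, ∃ (y : Fin (d + 1) → E d) (δ : Fin d),
    Descends S.points (τ S) y δ ∧ Set.range T.points = Set.range y

/-! ### Finite element functions -/

/-- A piecewise polynomial function, given by its polynomial on each element. -/
abbrev Piecewise (d : ℕ) := Elem d → MvPolynomial (Fin d) ℝ

/-- The polynomial function `ℝᵈ → ℝ` of a polynomial. -/
def polyFun {d : ℕ} (p : MvPolynomial (Fin d) ℝ) (x : E d) : ℝ :=
  MvPolynomial.eval (fun i => x i) p

/-- The function on `Ω` (defined off the null set of element boundaries, where the value is `0`)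
that a family of polynomials defines. -/
def Triangulation.pwFun {d : ℕ} {Ω : Set (E d)} (𝒯 : Triangulation d Ω) (v : Piecewise d)
    (x : E d) : ℝ :=
  ∑ T ∈ 𝒯.elems, T.interior.indicator (polyFun (v T)) x

/-- Its elementwise gradient (for a function in `H¹`, this is the weak gradient). -/
def Triangulation.pwGrad {d : ℕ} {Ω : Set (E d)} (𝒯 : Triangulation d Ω) (v : Piecewise d)
    (x : E d) : E d :=
  ∑ T ∈ 𝒯.elems, T.interior.indicator (gradient (polyFun (v T))) x

/-- The finite element space `𝕍_𝒯 = H¹₀(Ω) ∩ ∏_T ℙₙ(T)`. -/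
def Triangulation.space {d : ℕ} {Ω : Set (E d)} (𝒯 : Triangulation d Ω) (n : ℕ) :
    Set (Piecewise d) :=
  {v | (∀ T ∈ 𝒯.elems, (v T).totalDegree ≤ n) ∧ ∃ G, IsH10 Ω (𝒯.pwFun v) G}

/-- `u ∈ 𝕍_𝒯` is the Galerkin approximation: `a(u, φ) + ⟨b(u), φ⟩ = f(φ)` for `φ ∈ 𝕍_𝒯`. -/
def Triangulation.IsGalerkinSolution {d : ℕ} {Ω : Set (E d)} (𝒯 : Triangulation d Ω) (n : ℕ)
    (D : ProblemData d) (u : Piecewise d) : Prop :=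
  u ∈ 𝒯.space n ∧ ∀ φ ∈ 𝒯.space n,
    IntegrableOn (fun x => D.b x (𝒯.pwFun u x) * 𝒯.pwFun φ x) Ω ∧
    (∫ x in Ω, inner ℝ (D.A x (𝒯.pwGrad u x)) (𝒯.pwGrad φ x)) +
        (∫ x in Ω, D.b x (𝒯.pwFun u x) * 𝒯.pwFun φ x)
      = ∫ x in Ω, D.f x * 𝒯.pwFun φ x

/-! ### Residuals and error indicators -/

/-- Divergence of a vector field. -/
def divergence {d : ℕ} (F : E d → E d) (x : E d) : ℝ :=
  ∑ i : Fin d, (fderiv ℝ F x (EuclideanSpace.single i 1)) i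

/-- Divergence of a symmetric matrix field: the vector `∑ᵢ (∂ᵢ A) eᵢ`. -/
def matDiv {d : ℕ} (A : E d → (E d →L[ℝ] E d)) (x : E d) : E d :=
  ∑ i : Fin d, (fderiv ℝ A x (EuclideanSpace.single i 1)) (EuclideanSpace.single i 1)

/-- Primal residual `R(v) = f + ∇·(A∇v) - b(v)` of a polynomial `p` (the restriction of `v` to an
element). -/
def primalResidual {d : ℕ} (D : ProblemData d) (p : MvPolynomial (Fin d) ℝ) (x : E d) : ℝ :=
  D.f x + divergence (fun y => D.A y (gradient (polyFun p) y)) x - D.b x (polyFun p x)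

/-- Residual `g + ∇·(A∇v) - b'(u) v` of the dual problem linearized about the function `u`. -/
def dualResidual {d : ℕ} (D : ProblemData d) (g u : E d → ℝ) (p : MvPolynomial (Fin d) ℝ)
    (x : E d) : ℝ :=
  g x + divergence (fun y => D.A y (gradient (polyFun p) y)) x
    - deriv (D.b x) (u x) * polyFun p x

/-- Outward unit normal of `T` on the face opposite to the vertex `i`. -/
def outwardNormal {d : ℕ} [NeZero d] (T : Elem d) (i : Fin (d + 1)) : E d :=
  (T.height i)⁻¹ • (T.altitudeFoot i - T.points i)

open Classical in
/-- The elements `T'` of `𝒯` such that `T ∩ T'` is the face of `T` opposite to the vertex `i`. -/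
def Triangulation.neighbors {d : ℕ} [NeZero d] {Ω : Set (E d)} (𝒯 : Triangulation d Ω)
    (T : Elem d) (i : Fin (d + 1)) : Finset (Elem d) :=
  𝒯.elems.filter fun T' =>
    T.closedInterior ∩ T'.closedInterior = (T.faceOpposite i).closedInterior

/-- The patch `ω_T`: the union of `T` and the elements that share a true hyperface with `T`. -/
def Triangulation.patch {d : ℕ} [NeZero d] {Ω : Set (E d)} (𝒯 : Triangulation d Ω)
    (T : Elem d) : Set (E d) :=
  T.closedInterior ∪ ⋃ i, ⋃ T' ∈ 𝒯.neighbors T i, T'.closedInterior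

/-- `‖J_T(v)‖²_{L²(∂T)}`, where `J_T(v)` is the jump of `A∇v · n` across `∂T`: on the face shared
with `T'`, the trace from `T'` (the limit from the outside) minus the trace from `T`. As usual
there is no jump on the part of `∂T` in `∂Ω`. -/
def Triangulation.jumpSq {d : ℕ} [NeZero d] {Ω : Set (E d)} (𝒯 : Triangulation d Ω)
    (A : E d → (E d →L[ℝ] E d)) (v : Piecewise d) (T : Elem d) : ℝ≥0∞ :=
  ∑ i : Fin (d + 1), ∑ T' ∈ 𝒯.neighbors T i,
    ∫⁻ x in (T.faceOpposite i).closedInterior ∩ Ω,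
      ‖inner ℝ (A x (gradient (polyFun (v T')) x)) (outwardNormal T i)
        - inner ℝ (A x (gradient (polyFun (v T)) x)) (outwardNormal T i)‖ₑ ^ 2 ∂μHE[d - 1]

/-- `(h_T² ‖r‖²_{L²(T)} + h_T ‖J_T(v)‖²_{L²(∂T)})^{1/2}` as an extended nonnegative number. -/
def Triangulation.indicator {d : ℕ} [NeZero d] {Ω : Set (E d)} (𝒯 : Triangulation d Ω)
    (A : E d → (E d →L[ℝ] E d)) (r : E d → ℝ) (v : Piecewise d) (T : Elem d) : ℝ≥0∞ :=
  (ENNReal.ofReal (meshSize T) ^ 2 * eLpNorm r 2 (volume.restrict T.closedInterior) ^ 2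
    + ENNReal.ofReal (meshSize T) * 𝒯.jumpSq A v T) ^ (1 / 2 : ℝ)

/-- The primal error indicator `η_𝒯(v, T)`. -/
def Triangulation.primalIndicator {d : ℕ} [NeZero d] {Ω : Set (E d)} (𝒯 : Triangulation d Ω)
    (D : ProblemData d) (v : Piecewise d) (T : Elem d) : ℝ≥0∞ :=
  𝒯.indicator D.A (primalResidual D (v T)) v T

/-- The error indicator on `𝒯` of the dual problem linearized about the function `u`. For `u` the
exact solution this is the limiting indicator `ζ_𝒯(v, T)`, for `u = u_j` the approximate one
`ζ_{𝒯,j}(v, T)`. -/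
def Triangulation.dualIndicator {d : ℕ} [NeZero d] {Ω : Set (E d)} (𝒯 : Triangulation d Ω)
    (D : ProblemData d) (g u : E d → ℝ) (v : Piecewise d) (T : Elem d) : ℝ≥0∞ :=
  𝒯.indicator D.A (dualResidual D g u (v T)) v T

/-- The data estimator
`η_𝒯(D, T) = h_T (‖div A‖²_{L∞(T)} + h_T⁻² ‖A‖²_{L∞(ω_T)} + B²)^{1/2}`. -/
def Triangulation.dataEstimator {d : ℕ} [NeZero d] {Ω : Set (E d)} (𝒯 : Triangulation d Ω)
    (A : E d → (E d →L[ℝ] E d)) (B : ℝ) (T : Elem d) : ℝ :=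
  √(meshSize T ^ 2 *
    ((eLpNorm (matDiv A) ⊤ (volume.restrict T.closedInterior)).toReal ^ 2
      + (meshSize T)⁻¹ ^ 2 * (eLpNorm A ⊤ (volume.restrict (𝒯.patch T))).toReal ^ 2
      + B ^ 2))

/-- The norm `‖v‖_{H¹(ω_T)}`. -/
def Triangulation.patchNorm {d : ℕ} [NeZero d] {Ω : Set (E d)} (𝒯 : Triangulation d Ω)
    (v : Piecewise d) (T : Elem d) : ℝ :=
  √((eLpNorm (𝒯.pwGrad v) 2 (volume.restrict (𝒯.patch T))).toReal ^ 2
    + (eLpNorm (𝒯.pwFun v) 2 (volume.restrict (𝒯.patch T))).toReal ^ 2)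

/-- `|a - b| ≤ c` for extended nonnegative `a`, `b`: they are finite or infinite together, and
the inequality holds if they are finite. -/
def AbsDiffLE (a b : ℝ≥0∞) (c : ℝ) : Prop :=
  (a = ⊤ ↔ b = ⊤) ∧ |a.toReal - b.toReal| ≤ c

end Goafem

end

open Goafem

/-!
Each error indicator is a weighted `ℓ²` combination of the `L²(T)` norm of a residual and the
`L²` norms of the jumps over the faces of `T`, so by Minkowski's inequality
(`lintegral_sq_rpow_le_add`, `sqrt_weighted_sum_le_add`, `Triangulation.indicator_le_add`) two
indicators differ at most by the same combination of the differences. These depend only on the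
difference `q = v - w`:

* the residual difference is `div (A ∇q)` up to a term bounded by `B |q|`. The latter comes from the
  Lipschitz bound of `b`, or from `|b'| ≤ B` on a nondegenerate interval
  (`abs_deriv_le_of_lipschitzOnWith_Icc`). By Rademacher's theorem and the product rule,
  `|div (A ∇q)| ≤ |div A| |∇q| + C |A| |∇²q|` almost everywhere (`abs_divergence_flux_le`), and an
  inverse estimate turns `∇²q` into `h_T⁻¹ ∇q`;
* the jump difference is at most `‖A‖` times the sum of `|∇q|` from both sides of the face. An
  inverse estimate bounds these traces by `h_T^{-d/2} ‖∇q‖`, and the face has measure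
  `O(h_T^{d-1})`.

All constants must depend on `d`, `n` and `σ` only. The inverse estimates
(`exists_gradient_inverse_estimate`) follow by scaling from the equivalence of norms on polynomials
over a reference simplex, given shape regularity. Shape regularity of the refinement
(`Triangulation.IsRefinement.shapeRegular`) holds because a tagged simplex is determined by a path
of `d` steps (`IsPathSimplex`): bisection reverses an initial part of the path, and halves the whole
path once in every `d` generations, while each bisection halves the volume. Finally, neighbours
share an edge, so they have comparable sizes, and by a volume count there is a bounded number of
them (`Triangulation.card_neighbors_le`).
-/

noncomputable section

namespace Goafem

/-! ### Minkowski inequalities without measurability -/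

/-- Minkowski's inequality in `L²` for possibly nonmeasurable `f` and `f'`: only the increment `g`
has to be measurable, because the lower integral of `f ^ 2` is attained by a measurable minorant. -/
theorem lintegral_sq_rpow_le_add {α : Type*} [MeasurableSpace α] {μ : Measure α}
    {f f' g : α → ℝ≥0∞} (hg : AEMeasurable g μ) (h : ∀ᵐ x ∂μ, f x ≤ f' x + g x) :
    (∫⁻ x, f x ^ 2 ∂μ) ^ (1 / 2 : ℝ) ≤
      (∫⁻ x, f' x ^ 2 ∂μ) ^ (1 / 2 : ℝ) + (∫⁻ x, g x ^ 2 ∂μ) ^ (1 / 2 : ℝ) := by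
  obtain ⟨φ, hφm, hφ, hφi⟩ := exists_measurable_le_lintegral_eq μ (fun x => f x ^ 2)
  have hroot : ∀ x, (φ x ^ (1 / 2 : ℝ)) ^ 2 = φ x := by
    intro x
    rw [← ENNReal.rpow_natCast, ← ENNReal.rpow_mul]
    norm_num
  have hψf : ∀ x, φ x ^ (1 / 2 : ℝ) ≤ f x := by
    intro x
    have h1 := ENNReal.rpow_le_rpow (hφ x) (by norm_num : (0 : ℝ) ≤ 1 / 2)
    beta_reduce at h1
    rwa [← ENNReal.rpow_natCast (f x), ← ENNReal.rpow_mul,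
      show ((2 : ℕ) : ℝ) * (1 / 2) = 1 by norm_num,
      ENNReal.rpow_one] at h1
  have hmin : ∀ᵐ x ∂μ, φ x ^ (1 / 2 : ℝ) - g x ≤ f' x := by
    filter_upwards [h] with x hx
    exact tsub_le_iff_right.2 ((hψf x).trans hx)
  have hm : AEMeasurable (fun x => φ x ^ (1 / 2 : ℝ) - g x) μ :=
    (hφm.pow_const _).aemeasurable.sub hg
  have key := ENNReal.lintegral_Lp_add_le (p := 2) hm hg one_le_two
  simp only [Pi.add_apply, ENNReal.rpow_ofNat] at key
  rw [hφi]
  calc (∫⁻ x, φ x ∂μ) ^ (1 / 2 : ℝ)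
      ≤ (∫⁻ x, (φ x ^ (1 / 2 : ℝ) - g x + g x) ^ 2 ∂μ) ^ (1 / 2 : ℝ) := by
        gcongr with x
        rw [← hroot x]
        gcongr
        rw [hroot x]
        exact le_tsub_add
    _ ≤ _ := key
    _ ≤ _ := by
        gcongr ?_ + _
        refine ENNReal.rpow_le_rpow (lintegral_mono_ae ?_) (by norm_num)
        filter_upwards [hmin] with x hx
        gcongr

theorem eLpNorm_two_eq {α F : Type*} [MeasurableSpace α] [NormedAddCommGroup F] (μ : Measure α)
    (f : α → F) : eLpNorm f 2 μ = (∫⁻ x, ‖f x‖ₑ ^ 2 ∂μ) ^ (1 / 2 : ℝ) := by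
  rw [eLpNorm_eq_lintegral_rpow_enorm_toReal two_ne_zero ENNReal.ofNat_ne_top]
  simp

/-- Weighted `ℓ²` Minkowski inequality in the form of the error indicators. -/
theorem sqrt_weighted_sum_le_add {ι : Type*} (s : Finset ι) (c e a a' ρ : ℝ≥0∞)
    (b b' κ : ι → ℝ≥0∞) (ha : a ≤ a' + ρ)
    (hb : ∀ i ∈ s, b i ^ (1 / 2 : ℝ) ≤ b' i ^ (1 / 2 : ℝ) + κ i) :
    (c ^ 2 * a ^ 2 + e * ∑ i ∈ s, b i) ^ (1 / 2 : ℝ) ≤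
      (c ^ 2 * a' ^ 2 + e * ∑ i ∈ s, b' i) ^ (1 / 2 : ℝ) +
        (c ^ 2 * ρ ^ 2 + e * ∑ i ∈ s, κ i ^ 2) ^ (1 / 2 : ℝ) := by
  have hsq : ∀ x : ℝ≥0∞, (x ^ (1 / 2 : ℝ)) ^ 2 = x := by
    intro x
    rw [← ENNReal.rpow_natCast, ← ENNReal.rpow_mul]
    norm_num
  have key := ENNReal.Lp_add_le (Finset.insertNone s)
    (fun o => o.elim (c * a') fun i => e ^ (1 / 2 : ℝ) * b' i ^ (1 / 2 : ℝ))
    (fun o => o.elim (c * ρ) fun i => e ^ (1 / 2 : ℝ) * κ i) (p := 2) one_le_two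
  simp only [Finset.sum_insertNone, Option.elim, ENNReal.rpow_ofNat, mul_pow, ← mul_add, hsq,
    ← Finset.mul_sum] at key
  refine le_trans (ENNReal.rpow_le_rpow ?_ (by norm_num)) key
  gcongr with i hi
  rw [← hsq (b i)]
  gcongr
  exact hb i hi

theorem absDiffLE_of_le_add {a b c : ℝ≥0∞} {C : ℝ} (hC : 0 ≤ C) (hc : c ≤ ENNReal.ofReal C)
    (hab : a ≤ b + c) (hba : b ≤ a + c) : AbsDiffLE a b C := by
  have hct : c ≠ ⊤ := ne_top_of_le_ne_top ENNReal.ofReal_ne_top hc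
  have key : ∀ {x y : ℝ≥0∞}, x ≤ y + c → y ≠ ⊤ → x.toReal ≤ y.toReal + C := by
    intro x y h hy
    have h1 : x ≤ y + ENNReal.ofReal C := h.trans (by gcongr)
    have h2 := ENNReal.toReal_mono (by simp [hy]) h1
    rwa [ENNReal.toReal_add hy ENNReal.ofReal_ne_top, ENNReal.toReal_ofReal hC] at h2
  have ht : a = ⊤ ↔ b = ⊤ := by
    constructor
    · intro h
      by_contra hb
      exact (ne_top_of_le_ne_top (by simp [hb, hct]) hab) h
    · intro h
      by_contra hb
      exact (ne_top_of_le_ne_top (by simp [hb, hct]) hba) h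
  refine ⟨ht, ?_⟩
  by_cases hb : b = ⊤
  · simp [ht.2 hb, hb, hC]
  · have ha : a ≠ ⊤ := fun h => hb (ht.1 h)
    rw [abs_le]
    have := key hab hb
    have := key hba ha
    constructor <;> linarith

/-! ### Simplices as affine images of a reference simplex -/

theorem norm_le_sum_abs {d : ℕ} (z : E d) : ‖z‖ ≤ ∑ i, |z i| := by
  have h : z = ∑ i, z i • EuclideanSpace.single i (1 : ℝ) := by
    ext j
    simp [Finset.sum_apply, Pi.single_apply]
  calc ‖z‖ = ‖∑ i, z i • EuclideanSpace.single i (1 : ℝ)‖ := by rw [← h]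
    _ ≤ ∑ i, ‖z i • EuclideanSpace.single i (1 : ℝ)‖ := norm_sum_le _ _
    _ = ∑ i, |z i| := by simp [norm_smul]

theorem abs_coord_le_norm {d : ℕ} (z : E d) (i : Fin d) : |z i| ≤ ‖z‖ :=
  PiLp.norm_apply_le z i

/-- The vertices `0, e₁, …, e_d` of the reference simplex. -/
def refVertex (d : ℕ) : Fin (d + 1) → E d :=
  Fin.cons 0 fun i => EuclideanSpace.single i 1

/-- The closed reference simplex with vertices `0, e₁, …, e_d`. -/
def refSimplex (d : ℕ) : Set (E d) := convexHull ℝ (Set.range (refVertex d))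

/-- The matrix whose columns are the edge vectors of a vertex tuple from its first vertex. -/
def edgeMatrix {d : ℕ} (y : Fin (d + 1) → E d) : Matrix (Fin d) (Fin d) ℝ :=
  Matrix.of fun i j => y j.succ i - y 0 i

/-- The linear map sending the `j`-th unit vector to the `j`-th edge vector. -/
def edgeMap {k d : ℕ} (y : Fin (k + 1) → E d) : E k →L[ℝ] E d :=
  ∑ j, (EuclideanSpace.proj j : E k →L[ℝ] ℝ).smulRight (y j.succ - y 0)

theorem edgeMap_apply {k d : ℕ} (y : Fin (k + 1) → E d) (z : E k) :
    edgeMap y z = ∑ j, z j • (y j.succ - y 0) := by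
  simp [edgeMap]

theorem edgeMap_coord {d : ℕ} (y : Fin (d + 1) → E d) (z : E d) (i : Fin d) :
    edgeMap y z i = (edgeMatrix y).mulVec z i := by
  rw [edgeMap_apply]
  simp [edgeMatrix, Matrix.mulVec, dotProduct, mul_comm]

theorem edgeMap_single {k d : ℕ} (y : Fin (k + 1) → E d) (j : Fin k) :
    edgeMap y (EuclideanSpace.single j 1) = y j.succ - y 0 := by
  rw [edgeMap_apply]
  simp [ite_smul]

theorem det_edgeMap {d : ℕ} (y : Fin (d + 1) → E d) :
    LinearMap.det (edgeMap y : E d →ₗ[ℝ] E d) = (edgeMatrix y).det := by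
  rw [← LinearMap.det_toMatrix (EuclideanSpace.basisFun (Fin d) ℝ).toBasis]
  congr 1
  ext i j
  simp [LinearMap.toMatrix_apply, edgeMap_single, edgeMatrix]

theorem refVertex_map {k d : ℕ} (y : Fin (k + 1) → E d) (i : Fin (k + 1)) :
    y 0 + edgeMap y (refVertex k i) = y i := by
  refine Fin.cases ?_ (fun j => ?_) i
  · simp [refVertex]
  · simp [refVertex, edgeMap_single]

theorem convexHull_range_eq_image {k d : ℕ} (y : Fin (k + 1) → E d) :
    convexHull ℝ (Set.range y) = (fun z => y 0 + edgeMap y z) '' refSimplex k := by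
  let F : E k →ᵃ[ℝ] E d :=
    AffineMap.const ℝ (E k) (y 0) + (edgeMap y : E k →ₗ[ℝ] E d).toAffineMap
  have hF : (fun z => y 0 + edgeMap y z) = F := by
    ext z
    simp [F]
  rw [hF, refSimplex, AffineMap.image_convexHull, ← Set.range_comp]
  congr 2
  ext1 i
  rw [Function.comp_apply]
  rw [← hF]
  exact (refVertex_map y i).symm

theorem isCompact_refSimplex (d : ℕ) : IsCompact (refSimplex d) :=
  (Set.finite_range _).isCompact_convexHull ℝ

theorem nonempty_interior_refSimplex (d : ℕ) : (interior (refSimplex d)).Nonempty := by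
  rw [refSimplex, interior_convexHull_nonempty_iff_affineSpan_eq_top,
    AffineSubspace.affineSpan_eq_top_iff_vectorSpan_eq_top_of_nonempty _ _ _ (Set.range_nonempty _),
    vectorSpan_range_eq_span_range_vsub_right ℝ (refVertex d) 0, eq_top_iff,
    ← (EuclideanSpace.basisFun (Fin d) ℝ).toBasis.span_eq]
  refine Submodule.span_mono ?_
  rintro _ ⟨i, rfl⟩
  exact ⟨i.succ, by simp [refVertex]⟩

theorem volume_refSimplex_pos (d : ℕ) : 0 < volume (refSimplex d) :=
  Measure.measure_pos_of_nonempty_interior volume (nonempty_interior_refSimplex d)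

theorem volume_refSimplex_lt_top (d : ℕ) : volume (refSimplex d) < ⊤ :=
  (isCompact_refSimplex d).measure_lt_top

theorem volume_real_refSimplex_pos (d : ℕ) : 0 < volume.real (refSimplex d) :=
  ENNReal.toReal_pos (volume_refSimplex_pos d).ne' (volume_refSimplex_lt_top d).ne

theorem volume_convexHull_range {d : ℕ} (y : Fin (d + 1) → E d) :
    volume.real (convexHull ℝ (Set.range y)) =
      |(edgeMatrix y).det| * volume.real (refSimplex d) := by
  rw [convexHull_range_eq_image, ← Set.image_image (fun z => y 0 + z) (edgeMap y), Measure.real,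
    Set.image_add_left, measure_preimage_add, Measure.addHaar_image_continuousLinearMap,
    ENNReal.toReal_mul, ENNReal.toReal_ofReal (abs_nonneg _), det_edgeMap, Measure.real]

/-- Cramer's rule bounds the inverse of the edge map: the replaced column contributes `‖L z‖`, the
others at most `D` each. -/
theorem abs_det_mul_abs_coord_le {d : ℕ} (y : Fin (d + 1) → E d) {D : ℝ} (hD : 0 < D)
    (hy : ∀ j : Fin d, ‖y j.succ - y 0‖ ≤ D) (z : E d) (i : Fin d) :
    |(edgeMatrix y).det| * |z i| * D ≤ d.factorial * D ^ d * ‖edgeMap y z‖ := by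
  have hcol : ∀ w : E d, ‖w‖ ≤ D → |((edgeMatrix y).updateCol i w).det| ≤ d.factorial * D ^ d := by
    intro w hw
    have := Matrix.det_le (A := (edgeMatrix y).updateCol i w) (abv := AbsoluteValue.abs) (x := D) ?_
    · simpa [nsmul_eq_mul] using this
    · intro k l
      rw [Matrix.updateCol_apply]
      split_ifs
      · exact (abs_coord_le_norm w k).trans hw
      · exact (abs_coord_le_norm (y l.succ - y 0) k).trans (hy l)
  have hcr : ((edgeMatrix y).updateCol i (edgeMap y z)).det = (edgeMatrix y).det * z i := by
    have h1 : (edgeMap y z : Fin d → ℝ) = (edgeMatrix y).mulVec z := funext (edgeMap_coord y z)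
    rw [h1, ← Matrix.cramer_apply, Matrix.cramer_eq_adjugate_mulVec, Matrix.mulVec_mulVec,
      Matrix.adjugate_mul, Matrix.smul_mulVec, Matrix.one_mulVec]
    simp
  rcases eq_or_ne (edgeMap y z) 0 with h0 | h0
  · have h2 : (edgeMatrix y).det * z i = 0 := by
      rw [← hcr, h0]
      exact Matrix.det_eq_zero_of_column_eq_zero i fun k => by simp
    rw [← abs_mul, h2, h0]
    simp
  · have hn : 0 < ‖edgeMap y z‖ := norm_pos_iff.2 h0
    have h3 := hcol ((D / ‖edgeMap y z‖) • edgeMap y z) (by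
      rw [norm_smul, Real.norm_of_nonneg (by positivity), div_mul_cancel₀ _ hn.ne'])
    have h4 : (((D / ‖edgeMap y z‖) • edgeMap y z : E d) : Fin d → ℝ) =
        (D / ‖edgeMap y z‖) • (edgeMap y z : Fin d → ℝ) := rfl
    rw [h4, Matrix.det_updateCol_smul, hcr, abs_mul, abs_mul, abs_of_pos (by positivity),
      div_mul_eq_mul_div, div_le_iff₀ hn] at h3
    linarith

theorem abs_det_mul_norm_le {d : ℕ} (y : Fin (d + 1) → E d) {D : ℝ} (hD : 0 < D)
    (hy : ∀ j : Fin d, ‖y j.succ - y 0‖ ≤ D) (z : E d) :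
    |(edgeMatrix y).det| * ‖z‖ * D ≤ d * d.factorial * D ^ d * ‖edgeMap y z‖ := by
  calc |(edgeMatrix y).det| * ‖z‖ * D ≤ |(edgeMatrix y).det| * (∑ i, |z i|) * D := by
        gcongr
        exact norm_le_sum_abs z
    _ = ∑ i, |(edgeMatrix y).det| * |z i| * D := by rw [Finset.mul_sum, Finset.sum_mul]
    _ ≤ ∑ _i : Fin d, d.factorial * D ^ d * ‖edgeMap y z‖ :=
        Finset.sum_le_sum fun i _ => abs_det_mul_abs_coord_le y hD hy z i
    _ = _ := by simp; ring

/-! ### Elements -/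

theorem affineSpan_range_points {d : ℕ} (T : Elem d) : affineSpan ℝ (Set.range T.points) = ⊤ := by
  rw [T.independent.affineSpan_eq_top_iff_card_eq_finrank_add_one]
  simp

theorem interior_eq {d : ℕ} [NeZero d] (T : Elem d) :
    T.interior = _root_.interior T.closedInterior := by
  let b : AffineBasis (Fin (d + 1)) ℝ (E d) :=
    ⟨T.points, T.independent, affineSpan_range_points T⟩
  have hb : _root_.interior T.closedInterior = {x | ∀ i, 0 < b.coord i x} := by
    rw [← b.interior_convexHull, ← T.convexHull_eq_closedInterior]
    rfl
  rw [hb]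
  ext x
  have hx : x = Finset.univ.affineCombination ℝ T.points (fun i => b.coord i x) :=
    (b.affineCombination_coord_eq_self x).symm
  have hs : ∑ i, b.coord i x = 1 := b.sum_coord_apply_eq_one x
  constructor
  · intro h i
    rw [hx, T.affineCombination_mem_interior_iff hs] at h
    exact (h i).1
  · intro h
    rw [hx, T.affineCombination_mem_interior_iff hs]
    intro i
    refine ⟨h i, ?_⟩
    have : Nontrivial (Fin (d + 1)) := Fin.nontrivial_iff_two_le.2 (by have := NeZero.pos d; omega)
    obtain ⟨j, hj⟩ := exists_ne i
    have h2 : b.coord i x + b.coord j x ≤ ∑ k, b.coord k x := by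
      rw [← Finset.sum_pair (f := fun k => b.coord k x) hj.symm]
      exact Finset.sum_le_sum_of_subset_of_nonneg (Finset.subset_univ _) fun k _ _ => (h k).le
    have := h j
    linarith

section Elem
variable {d : ℕ} (T : Elem d)

theorem convex_closedInterior : Convex ℝ T.closedInterior := by
  rw [← T.convexHull_eq_closedInterior]
  exact convex_convexHull _ _

theorem nonempty_interior_closedInterior : (_root_.interior T.closedInterior).Nonempty := by
  rw [← T.convexHull_eq_closedInterior, interior_convexHull_nonempty_iff_affineSpan_eq_top]
  exact affineSpan_range_points T

theorem volume_closedInterior_pos : 0 < volume T.closedInterior :=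
  Measure.measure_pos_of_nonempty_interior volume (nonempty_interior_closedInterior T)

theorem volume_closedInterior_lt_top : volume T.closedInterior < ⊤ :=
  T.isCompact_closedInterior.measure_lt_top

theorem volume_real_closedInterior_pos : 0 < volume.real T.closedInterior :=
  ENNReal.toReal_pos (volume_closedInterior_pos T).ne' (volume_closedInterior_lt_top T).ne

theorem meshSize_pos : 0 < meshSize T := Real.rpow_pos_of_pos (volume_real_closedInterior_pos T) _

theorem dist_le_diam {x y : E d} (hx : x ∈ T.closedInterior) (hy : y ∈ T.closedInterior) :
    dist x y ≤ Metric.diam T.closedInterior :=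
  Metric.dist_le_diam_of_mem T.isCompact_closedInterior.isBounded hx hy

variable [NeZero d]

theorem isOpen_simplex_interior : IsOpen T.interior := by
  rw [interior_eq]
  exact isOpen_interior

theorem closure_simplex_interior : closure T.interior = T.closedInterior := by
  rw [interior_eq, (convex_closedInterior T).closure_interior_eq_closure_of_nonempty_interior
    (nonempty_interior_closedInterior T), T.isClosed_closedInterior.closure_eq]

theorem simplex_interior_ae_eq : T.interior =ᵐ[volume] T.closedInterior := by
  rw [interior_eq]
  exact interior_ae_eq_of_null_frontier ((convex_closedInterior T).addHaar_frontier volume)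

theorem meshSize_pow : meshSize T ^ d = volume.real T.closedInterior := by
  rw [meshSize, ← Real.rpow_natCast, ← Real.rpow_mul measureReal_nonneg]
  rw [one_div_mul_cancel (by exact_mod_cast NeZero.ne d), Real.rpow_one]

theorem meshSize_pow_eq_det :
    meshSize T ^ d = |(edgeMatrix T.points).det| * volume.real (refSimplex d) := by
  rw [meshSize_pow, ← volume_convexHull_range, T.convexHull_eq_closedInterior]

theorem abs_det_pos : 0 < |(edgeMatrix T.points).det| := by
  have h := meshSize_pow_eq_det T
  have h1 := pow_pos (meshSize_pos T) d
  rw [h] at h1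
  exact pos_of_mul_pos_left h1 (volume_real_refSimplex_pos d).le

/-- In a shape regular simplex, the inverse of the edge map has norm `O(1 / h_T)`. -/
theorem norm_le_of_shapeRegular {s : ℝ} (hs : 0 < s)
    (hT : Metric.diam T.closedInterior ≤ s * meshSize T) (z : E d) :
    meshSize T * ‖z‖ ≤
      volume.real (refSimplex d) * d * d.factorial * s ^ (d - 1) * ‖edgeMap T.points z‖ := by
  have hh := meshSize_pos T
  have hκ := volume_real_refSimplex_pos d
  have hy : ∀ j : Fin d, ‖T.points j.succ - T.points 0‖ ≤ s * meshSize T := by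
    intro j
    rw [← dist_eq_norm]
    exact (dist_le_diam T (T.point_mem_closedInterior _) (T.point_mem_closedInterior _)).trans hT
  have h := abs_det_mul_norm_le T.points (mul_pos hs hh) hy z
  have h2 := mul_le_mul_of_nonneg_left h hκ.le
  have hd : s ^ d = s ^ (d - 1) * s := by
    rw [← pow_succ, Nat.sub_add_cancel (NeZero.pos d)]
  have h3 : s * meshSize T ^ d * (meshSize T * ‖z‖) ≤ s * meshSize T ^ d *
      (volume.real (refSimplex d) * d * d.factorial * s ^ (d - 1) * ‖edgeMap T.points z‖) := by
    calc s * meshSize T ^ d * (meshSize T * ‖z‖)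
        = volume.real (refSimplex d) *
          (|(edgeMatrix T.points).det| * ‖z‖ * (s * meshSize T)) := by
          rw [meshSize_pow_eq_det]; ring
      _ ≤ _ := h2
      _ = _ := by rw [mul_pow, hd]; ring
  exact le_of_mul_le_mul_left h3 (by positivity)

/-- In a shape regular simplex, every edge has length at least a multiple of `h_T`. -/
theorem meshSize_le_edge {s : ℝ} (hs : 0 < s)
    (hT : Metric.diam T.closedInterior ≤ s * meshSize T) {i j : Fin (d + 1)} (hij : i ≠ j) :
    meshSize T ≤ volume.real (refSimplex d) * d * d.factorial * s ^ (d - 1) *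
      dist (T.points i) (T.points j) := by
  have h := norm_le_of_shapeRegular T hs hT (refVertex d i - refVertex d j)
  have h1 : edgeMap T.points (refVertex d i - refVertex d j) = T.points i - T.points j := by
    rw [map_sub]
    have hi := refVertex_map T.points i
    have hj := refVertex_map T.points j
    have h0 := congrArg₂ (fun p q : E d => p - q) hi hj
    simpa only [add_sub_add_left_eq_sub] using h0
  have h2 : 1 ≤ ‖refVertex d i - refVertex d j‖ := by
    have hcoord : ∀ k l : Fin (d + 1), k ≠ l → l ≠ 0 → 1 ≤ ‖refVertex d l - refVertex d k‖ := by
      intro k l hkl hl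
      obtain ⟨m, rfl⟩ := Fin.exists_succ_eq.2 hl
      refine le_trans ?_ (abs_coord_le_norm _ m)
      revert hkl
      refine Fin.cases ?_ (fun k' => ?_) k
      · simp [refVertex]
      · intro hkl
        have : m ≠ k' := fun h => hkl (by rw [h])
        simp [refVertex, this]
    by_cases hi : i = 0
    · rw [norm_sub_rev]
      exact hcoord i j hij (fun h => hij (hi.trans h.symm))
    · exact hcoord j i hij.symm hi
  rw [h1, ← dist_eq_norm] at h
  refine le_trans ?_ h
  exact le_mul_of_one_le_right (meshSize_pos T).le h2

end Elem

/-! ### Newest vertex bisection preserves shape regularity -/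

/-- The tuple `y` is a tagged simplex of type `γ` cut out of a path `P` with steps of length at most
`R`: the vertices `y₀, y_{γ+1}, …, y_d` are the first `d - γ + 1` points of the path, and
`y₁, …, y_γ` are the midpoints between `y₀` and the following points of the path. Every tagged
simplex is of this form, and bisection only reverses an initial part of the path, or halves the
whole path when the type wraps around to `0`. -/
def IsPathSimplex {d : ℕ} (y : Fin (d + 1) → E d) (γ : ℕ) (R : ℝ) : Prop :=
  ∃ P : ℕ → E d, P 0 = 0 ∧ (∀ k, ‖P (k + 1) - P k‖ ≤ R) ∧
    (∀ i : Fin (d + 1), 0 < (i : ℕ) → (i : ℕ) ≤ γ → y i = y 0 + (1 / 2 : ℝ) • P (d - γ + i)) ∧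
    (∀ i : Fin (d + 1), γ < (i : ℕ) → y i = y 0 + P (i - γ))

theorem midpoint_eq_add_half_smul {d : ℕ} (p q : E d) :
    midpoint ℝ p (p + q) = p + (1 / 2 : ℝ) • q := by
  rw [midpoint_eq_smul_add, invOf_eq_inv]
  module

theorem bisectFst_zero {d : ℕ} (y : Fin (d + 1) → E d) : bisectFst y 0 = y 0 := by
  simp [bisectFst]

theorem IsPathSimplex.bisectFst_succ {d : ℕ} {y : Fin (d + 1) → E d} {γ : ℕ} {R : ℝ}
    (h : IsPathSimplex y γ R) (hγ : γ + 1 < d) : IsPathSimplex (bisectFst y) (γ + 1) R := by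
  obtain ⟨P, h0, hR, hlow, hhigh⟩ := h
  refine ⟨P, h0, hR, ?_, ?_⟩
  · intro i hi hiγ
    rw [bisectFst_zero, bisectFst, if_neg hi.ne']
    split_ifs with h1
    · rw [hhigh (Fin.last d) (by simp; omega), midpoint_eq_add_half_smul, Fin.val_last,
        show d - (γ + 1) + (i : ℕ) = d - γ by omega]
    · have hv : ((Fin.ofNat (d + 1) ((i : ℕ) - 1) : Fin (d + 1)) : ℕ) = i - 1 := by
        rw [Fin.val_ofNat, Nat.mod_eq_of_lt (by omega)]
      rw [hlow _ (by omega) (by omega), hv, show d - (γ + 1) + (i : ℕ) = d - γ + (i - 1) by omega]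
  · intro i hi
    have hv : ((Fin.ofNat (d + 1) ((i : ℕ) - 1) : Fin (d + 1)) : ℕ) = i - 1 := by
      rw [Fin.val_ofNat, Nat.mod_eq_of_lt (by omega)]
    rw [bisectFst_zero, bisectFst, if_neg (by omega), if_neg (by omega), hhigh _ (by omega), hv,
      show (i : ℕ) - 1 - γ = i - (γ + 1) by omega]

theorem IsPathSimplex.bisectFst_wrap {d : ℕ} {y : Fin (d + 1) → E d} {γ : ℕ} {R : ℝ}
    (h : IsPathSimplex y γ R) (hγ : γ + 1 = d) : IsPathSimplex (bisectFst y) 0 (R / 2) := by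
  obtain ⟨P, h0, hR, hlow, hhigh⟩ := h
  refine ⟨fun k => (1 / 2 : ℝ) • P k, by simp [h0], fun k => ?_, by omega, ?_⟩
  · rw [← smul_sub, norm_smul, Real.norm_of_nonneg (by norm_num)]
    linarith [hR k]
  · intro i hi
    rw [bisectFst_zero, bisectFst, if_neg hi.ne']
    split_ifs with h1
    · rw [hhigh (Fin.last d) (by simp; omega), midpoint_eq_add_half_smul, Fin.val_last,
        show d - γ = (i : ℕ) - 0 by omega]
    · have hv : ((Fin.ofNat (d + 1) ((i : ℕ) - 1) : Fin (d + 1)) : ℕ) = i - 1 := by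
        rw [Fin.val_ofNat, Nat.mod_eq_of_lt (by omega)]
      rw [hlow _ (by omega) (by omega), hv, show d - γ + ((i : ℕ) - 1) = i - 0 by omega]

/-- The tagged simplex of type `γ` with the same vertices in which the subtuple
`y₀, y_{γ+1}, …, y_d` is reversed; its first child is the second child of the original one. -/
def reflectTuple {d : ℕ} (y : Fin (d + 1) → E d) (γ : ℕ) : Fin (d + 1) → E d := fun i =>
  if (i : ℕ) = 0 then y (Fin.last d)
  else if (i : ℕ) ≤ γ then y i
  else if (i : ℕ) = d then y 0
  else y (Fin.ofNat (d + 1) (d + γ - i))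

theorem bisectSnd_eq_bisectFst_reflectTuple {d : ℕ} [NeZero d] (y : Fin (d + 1) → E d)
    (γ : Fin d) : bisectSnd y γ = bisectFst (reflectTuple y γ) := by
  have hγ := γ.2
  ext1 i
  rw [bisectSnd, bisectFst]
  split_ifs with h0 h1 h2
  · simp [reflectTuple]
  · rw [midpoint_comm]
    congr 1
    · rw [reflectTuple, Fin.val_last, if_neg (by omega), if_neg (by omega), if_pos rfl]
  · have hv : ((Fin.ofNat (d + 1) ((i : ℕ) - 1) : Fin (d + 1)) : ℕ) = i - 1 := by
      rw [Fin.val_ofNat, Nat.mod_eq_of_lt (by omega)]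
    rw [reflectTuple, hv, if_neg (by omega), if_pos (by omega)]
  · have hv : ((Fin.ofNat (d + 1) ((i : ℕ) - 1) : Fin (d + 1)) : ℕ) = i - 1 := by
      rw [Fin.val_ofNat, Nat.mod_eq_of_lt (by omega)]
    rw [reflectTuple, hv, if_neg (by omega), if_neg (by omega), if_neg (by omega),
      show d + (γ : ℕ) + 1 - i = d + γ - (i - 1) by omega]

theorem IsPathSimplex.reflect {d : ℕ} {y : Fin (d + 1) → E d} {γ : ℕ} {R : ℝ}
    (h : IsPathSimplex y γ R) (hγ : γ < d) : IsPathSimplex (reflectTuple y γ) γ R := by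
  obtain ⟨P, h0, hR, hlow, hhigh⟩ := h
  have hz : reflectTuple y γ 0 = y 0 + P (d - γ) := by
    rw [reflectTuple, if_pos (by simp), hhigh (Fin.last d) (by simpa using hγ), Fin.val_last]
  refine ⟨fun k => if k ≤ d - γ then P (d - γ - k) - P (d - γ) else P k - (2 : ℝ) • P (d - γ),
    ?_, ?_, ?_, ?_⟩
  · simp
  · intro k
    beta_reduce
    split_ifs with h1 h2
    · rw [sub_sub_sub_cancel_right, norm_sub_rev, show d - γ - k = d - γ - (k + 1) + 1 by omega]
      exact hR _
    · omega
    · have hk : k = d - γ := by omega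
      subst hk
      rw [Nat.sub_self, h0, show P (d - γ + 1) - (2 : ℝ) • P (d - γ) - (0 - P (d - γ)) =
        P (d - γ + 1) - P (d - γ) by module]
      exact hR _
    · rw [sub_sub_sub_cancel_right]
      exact hR k
  · intro i hi hiγ
    beta_reduce
    rw [hz, reflectTuple, if_neg hi.ne', if_pos hiγ, if_neg (by omega), hlow i hi hiγ]
    module
  · intro i hi
    have hid : (i : ℕ) ≤ d := by omega
    beta_reduce
    rw [hz, reflectTuple, if_neg (by omega), if_neg (by omega),
      if_pos (show (i : ℕ) - γ ≤ d - γ by omega)]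
    split_ifs with h1
    · rw [show d - γ - ((i : ℕ) - γ) = 0 by omega, h0]
      module
    · have hv : ((Fin.ofNat (d + 1) (d + γ - (i : ℕ)) : Fin (d + 1)) : ℕ) = d + γ - i := by
        rw [Fin.val_ofNat, Nat.mod_eq_of_lt (by omega)]
      rw [hhigh _ (by omega), hv, show d - γ - ((i : ℕ) - γ) = d + γ - i - γ by omega]
      module

/-- Every tagged simplex comes from a path. The factor `3` is due to the step from `y_d` to the
next point of the path, which is the reflection of `y₀` at `y₁`. -/
theorem isPathSimplex_of_dist_le {d : ℕ} {y : Fin (d + 1) → E d} {γ : ℕ} {D : ℝ} (hγ : γ < d)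
    (hy : ∀ i j, dist (y i) (y j) ≤ D) : IsPathSimplex y γ (3 * D) := by
  have hD : 0 ≤ D := dist_nonneg.trans (hy 0 0)
  have hn : ∀ i j, ‖y i - y j‖ ≤ D := fun i j => by rw [← dist_eq_norm]; exact hy i j
  let Y : ℕ → E d := fun k => y (Fin.ofNat (d + 1) k)
  have hY : ∀ i : Fin (d + 1), y i = Y i := fun i => by simp [Y]
  have hYn : ∀ k l, ‖Y k - Y l‖ ≤ D := fun k l => hn _ _
  have hY0 : Y 0 = y 0 := (hY 0).symm
  refine ⟨fun k => if k = 0 then 0 else if k ≤ d - γ then Y (γ + k) - Y 0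
    else (2 : ℝ) • (Y (min (k - (d - γ)) γ) - Y 0), by simp, ?_, ?_, ?_⟩
  · intro k
    beta_reduce
    rw [if_neg (Nat.succ_ne_zero k)]
    split_ifs with h1 h2 h3 h4
    · rw [sub_zero]
      linarith [hYn (γ + (k + 1)) 0]
    · rw [sub_sub_sub_cancel_right]
      linarith [hYn (γ + (k + 1)) (γ + k)]
    · omega
    · omega
    · rw [show ∀ a b c : E d, (2 : ℝ) • (a - c) - (b - c) = (a - c) + (a - b) from
        fun a b c => by module]
      refine (norm_add_le _ _).trans ?_
      linarith [hYn (min (k + 1 - (d - γ)) γ) 0, hYn (min (k + 1 - (d - γ)) γ) (γ + k)]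
    · rw [← smul_sub, sub_sub_sub_cancel_right, norm_smul, Real.norm_of_nonneg (by norm_num)]
      linarith [hYn (min (k + 1 - (d - γ)) γ) (min (k - (d - γ)) γ)]
  · intro i hi hiγ
    beta_reduce
    rw [if_neg (by omega), if_neg (by omega), hY i, ← hY0,
      show min (d - γ + (i : ℕ) - (d - γ)) γ = i by omega]
    module
  · intro i hi
    beta_reduce
    rw [if_neg (by omega), if_pos (by omega), hY i, ← hY0, show γ + ((i : ℕ) - γ) = i by omega]
    module

theorem IsPathSimplex.dist_le {d : ℕ} {y : Fin (d + 1) → E d} {γ : ℕ} {R : ℝ}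
    (h : IsPathSimplex y γ R) (hγ : γ < d) (i j : Fin (d + 1)) :
    dist (y i) (y j) ≤ 2 * d * R := by
  obtain ⟨P, h0, hR, hlow, hhigh⟩ := h
  have hR0 : 0 ≤ R := (norm_nonneg _).trans (hR 0)
  have hP : ∀ k, ‖P k‖ ≤ k * R := by
    intro k
    induction k with
    | zero => simp [h0]
    | succ k ih =>
      rw [← sub_add_cancel (P (k + 1)) (P k)]
      refine (norm_add_le _ _).trans ?_
      push_cast
      linarith [hR k]
  have hP' : ∀ k ≤ d, ‖P k‖ ≤ d * R := fun k hk => (hP k).trans (by gcongr)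
  have hdR : 0 ≤ d * R := by positivity
  have hz : ∀ i, dist (y i) (y 0) ≤ d * R := by
    intro i
    rw [dist_eq_norm]
    by_cases hi0 : i = 0
    · simpa [hi0] using hdR
    have hi1 : 0 < (i : ℕ) := Nat.pos_of_ne_zero fun h => hi0 (Fin.ext h)
    by_cases hi : (i : ℕ) ≤ γ
    · rw [hlow i hi1 hi, add_sub_cancel_left, norm_smul, Real.norm_of_nonneg (by norm_num)]
      linarith [hP' (d - γ + i) (by omega)]
    · rw [hhigh i (by omega), add_sub_cancel_left]
      exact hP' _ (by omega)
  linarith [dist_triangle_right (y i) (y j) (y 0), hz i, hz j]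

theorem abs_det_bisectFst {d : ℕ} (hd : d = 2 ∨ d = 3) (y : Fin (d + 1) → E d) :
    |(edgeMatrix (bisectFst y)).det| = |(edgeMatrix y).det| / 2 := by
  rcases hd with rfl | rfl
  · have h : (edgeMatrix (bisectFst y)).det = -((edgeMatrix y).det / 2) := by
      simp [Matrix.det_fin_two, edgeMatrix, bisectFst, midpoint_eq_smul_add, Fin.ofNat, Fin.last]
      ring
    rw [h, abs_neg, abs_div, abs_two]
  · have h : (edgeMatrix (bisectFst y)).det = (edgeMatrix y).det / 2 := by
      simp [Matrix.det_fin_three, edgeMatrix, bisectFst, midpoint_eq_smul_add, Fin.ofNat, Fin.last]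
      ring
    rw [h, abs_div, abs_two]

theorem range_reflectTuple {d : ℕ} (y : Fin (d + 1) → E d) {γ : ℕ} (hγ : γ < d) :
    Set.range (reflectTuple y γ) = Set.range y := by
  apply Set.Subset.antisymm
  · rintro _ ⟨i, rfl⟩
    rw [reflectTuple]
    split_ifs <;> exact Set.mem_range_self _
  · rintro _ ⟨i, rfl⟩
    by_cases h0 : (i : ℕ) = 0
    · refine ⟨Fin.last d, ?_⟩
      rw [reflectTuple, Fin.val_last, if_neg (by omega), if_neg (by omega), if_pos rfl]
      congr 1
      exact Fin.ext h0.symm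
    by_cases h1 : (i : ℕ) ≤ γ
    · exact ⟨i, by rw [reflectTuple, if_neg h0, if_pos h1]⟩
    by_cases h2 : (i : ℕ) = d
    · refine ⟨0, ?_⟩
      rw [reflectTuple, if_pos (by simp)]
      congr 1
      exact Fin.ext h2.symm
    have hv : ((Fin.ofNat (d + 1) (d + γ - (i : ℕ)) : Fin (d + 1)) : ℕ) = d + γ - i := by
      rw [Fin.val_ofNat, Nat.mod_eq_of_lt (by omega)]
    refine ⟨Fin.ofNat (d + 1) (d + γ - i), ?_⟩
    rw [reflectTuple, hv, if_neg (by omega), if_neg (by omega), if_neg (by omega),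
      show d + γ - (d + γ - (i : ℕ)) = i by omega]
    simp

theorem abs_det_reflectTuple {d : ℕ} (y : Fin (d + 1) → E d) {γ : ℕ} (hγ : γ < d) :
    |(edgeMatrix (reflectTuple y γ)).det| = |(edgeMatrix y).det| := by
  have h := volume_convexHull_range (reflectTuple y γ)
  rw [range_reflectTuple y hγ, volume_convexHull_range] at h
  exact (mul_right_cancel₀ (volume_real_refSimplex_pos d).ne' h).symm

/-- Along bisections, `R ^ d ≤ K * 2 ^ γ * |det|` is invariant: a step with `γ + 1 < d` halves the
volume and increments `γ`, and the wrap-around step halves both the volume and `R`. -/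
theorem Descends.exists_isPathSimplex {d : ℕ} [NeZero d] (hd : d = 2 ∨ d = 3)
    {x y : Fin (d + 1) → E d} {γ δ : Fin d} (h : Descends x γ y δ) {D : ℝ}
    (hx : ∀ i j, dist (x i) (x j) ≤ D) {K : ℝ} (hK : 0 ≤ K)
    (hDK : (3 * D) ^ d ≤ K * |(edgeMatrix x).det|) :
    ∃ R : ℝ, IsPathSimplex y δ R ∧ R ^ d ≤ K * 2 ^ (δ : ℕ) * |(edgeMatrix y).det| := by
  have hd1 : 1 < d := by omega
  have step : ∀ {y : Fin (d + 1) → E d} {δ : Fin d} {R : ℝ}, IsPathSimplex y δ R →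
      R ^ d ≤ K * 2 ^ (δ : ℕ) * |(edgeMatrix y).det| →
      ∃ R' : ℝ, IsPathSimplex (bisectFst y) (δ + 1 : Fin d) R' ∧
        R' ^ d ≤ K * 2 ^ ((δ + 1 : Fin d) : ℕ) * |(edgeMatrix (bisectFst y)).det| := by
    intro y δ R hy hR
    have h1 : ((1 : Fin d) : ℕ) = 1 := by
      rw [Fin.val_one', Nat.mod_eq_of_lt hd1]
    rw [abs_det_bisectFst hd]
    by_cases hδ : (δ : ℕ) + 1 < d
    · have hv : ((δ + 1 : Fin d) : ℕ) = δ + 1 := by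
        rw [Fin.val_add, h1, Nat.mod_eq_of_lt hδ]
      rw [hv]
      refine ⟨R, hy.bisectFst_succ hδ, hR.trans_eq ?_⟩
      rw [pow_succ]
      ring
    · have hδ' : (δ : ℕ) + 1 = d := by omega
      have hv : ((δ + 1 : Fin d) : ℕ) = 0 := by
        rw [Fin.val_add, h1, hδ', Nat.mod_self]
      rw [hv]
      refine ⟨R / 2, hy.bisectFst_wrap hδ', ?_⟩
      rw [div_pow, div_le_iff₀ (by positivity)]
      refine hR.trans_eq ?_
      have h2 : (2 : ℝ) ^ d = 2 ^ (δ : ℕ) * 2 := by rw [← pow_succ, hδ']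
      rw [h2]
      ring
  induction h with
  | refl =>
    refine ⟨3 * D, isPathSimplex_of_dist_le γ.2 hx, hDK.trans ?_⟩
    gcongr
    exact le_mul_of_one_le_right hK (one_le_pow₀ (by norm_num))
  | fst _ ih =>
    obtain ⟨R, hR, hR'⟩ := ih
    exact step hR hR'
  | @snd y δ _ ih =>
    obtain ⟨R, hR, hR'⟩ := ih
    rw [bisectSnd_eq_bisectFst_reflectTuple]
    exact step (hR.reflect δ.2) (by rwa [abs_det_reflectTuple y δ.2])

/-- Newest vertex bisection refinements are uniformly shape regular. The factor `12 d` is the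
product of `3` for the initial path, `2` for the factor `2 ^ δ ≤ 2 ^ d` in the invariant, and `2 d`
for the diameter of a simplex in terms of the steps of its path. -/
theorem Triangulation.IsRefinement.shapeRegular {d : ℕ} [NeZero d] (hd : d = 2 ∨ d = 3)
    {Ω : Set (E d)} {𝒯 𝒯₀ : Triangulation d Ω} {τ : Elem d → Fin d} (h : 𝒯.IsRefinement 𝒯₀ τ)
    {σ : ℝ} (hσ : 0 ≤ σ) (hreg : 𝒯₀.ShapeRegular σ) : 𝒯.ShapeRegular (12 * d * σ) := by
  intro T hT
  obtain ⟨S, hS, y, δ, hdesc, hrange⟩ := h T hT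
  have hκ := volume_real_refSimplex_pos d
  have hS0 := meshSize_pos S
  set κ := volume.real (refSimplex d) with hκdef
  have hx : ∀ i j, dist (S.points i) (S.points j) ≤ σ * meshSize S := fun i j =>
    (dist_le_diam S (S.point_mem_closedInterior i) (S.point_mem_closedInterior j)).trans
      (hreg S hS)
  obtain ⟨R, hR, hR'⟩ := hdesc.exists_isPathSimplex hd hx (K := (3 * σ) ^ d * κ) (by positivity) (by
    rw [← mul_assoc, mul_pow, meshSize_pow_eq_det]
    exact le_of_eq (by ring))
  have hR0 : 0 ≤ R := by
    obtain ⟨P, -, hP, -⟩ := hR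
    exact (norm_nonneg _).trans (hP 0)
  have hvol : meshSize T ^ d = |(edgeMatrix y).det| * κ := by
    rw [meshSize_pow, ← T.convexHull_eq_closedInterior, hrange, volume_convexHull_range]
  have hRT : R ≤ 6 * σ * meshSize T := by
    have hT0 := meshSize_pos T
    refine le_of_pow_le_pow_left₀ (NeZero.ne d) (by positivity) ?_
    calc R ^ d ≤ (3 * σ) ^ d * κ * 2 ^ (δ : ℕ) * |(edgeMatrix y).det| := hR'
      _ ≤ (3 * σ) ^ d * κ * 2 ^ d * |(edgeMatrix y).det| := by
        gcongr
        · norm_num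
        · exact δ.2.le
      _ = (3 * σ * 2) ^ d * meshSize T ^ d := by rw [hvol, mul_pow (3 * σ) 2]; ring
      _ = (6 * σ * meshSize T) ^ d := by rw [← mul_pow]; ring
  rw [← T.convexHull_eq_closedInterior, hrange, convexHull_diam]
  refine Metric.diam_le_of_forall_dist_le (mul_nonneg (by positivity) (meshSize_pos T).le) ?_
  rintro _ ⟨i, rfl⟩ _ ⟨j, rfl⟩
  calc dist (y i) (y j) ≤ 2 * d * R := hR.dist_le δ.2 i j
    _ ≤ 2 * d * (6 * σ * meshSize T) := by gcongr
    _ = 12 * d * σ * meshSize T := by ring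

/-! ### Calculus of polynomial functions -/

section Polynomial
variable {d : ℕ}

theorem polyFun_add (p q : MvPolynomial (Fin d) ℝ) : polyFun (p + q) = polyFun p + polyFun q := by
  ext x
  simp [polyFun]

theorem polyFun_sub (p q : MvPolynomial (Fin d) ℝ) (x : E d) :
    polyFun (p - q) x = polyFun p x - polyFun q x := by
  simp [polyFun]

theorem polyFun_smul (c : ℝ) (p : MvPolynomial (Fin d) ℝ) : polyFun (c • p) = c • polyFun p := by
  ext x
  simp [polyFun]

theorem continuous_polyFun (p : MvPolynomial (Fin d) ℝ) : Continuous (polyFun p) :=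
  (MvPolynomial.continuous_eval p).comp (by fun_prop)

theorem analyticOnNhd_polyFun (p : MvPolynomial (Fin d) ℝ) :
    AnalyticOnNhd ℝ (polyFun p) Set.univ :=
  AnalyticOnNhd.eval_continuousLinearMap (𝕜 := ℝ)
    ((EuclideanSpace.equiv (Fin d) ℝ : E d →L[ℝ] (Fin d → ℝ))) p

theorem hasFDerivAt_polyFun (p : MvPolynomial (Fin d) ℝ) (x : E d) :
    HasFDerivAt (polyFun p)
      (∑ i, polyFun (MvPolynomial.pderiv i p) x • (EuclideanSpace.proj i : E d →L[ℝ] ℝ)) x := by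
  induction p using MvPolynomial.induction_on with
  | C a =>
    have h : polyFun (MvPolynomial.C a : MvPolynomial (Fin d) ℝ) = fun _ => a := by
      ext x
      simp [polyFun]
    rw [h]
    simpa [polyFun] using hasFDerivAt_const (𝕜 := ℝ) a x
  | add p q hp hq =>
    rw [polyFun_add]
    refine (hp.add hq).congr_fderiv ?_
    simp [polyFun_add, add_smul, Finset.sum_add_distrib]
  | mul_X p j hp =>
    have hj : HasFDerivAt (fun x : E d => x j) (EuclideanSpace.proj j : E d →L[ℝ] ℝ) x :=
      (EuclideanSpace.proj j : E d →L[ℝ] ℝ).hasFDerivAt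
    have h := hp.mul hj
    have he : polyFun (p * MvPolynomial.X j) = polyFun p * fun x : E d => x j := by
      ext x
      simp [polyFun]
    rw [he]
    refine h.congr_fderiv ?_
    ext v
    simp [polyFun, Pi.single_apply, add_mul, Finset.sum_add_distrib, Finset.mul_sum]
    congr 1
    · rw [Finset.sum_eq_single j (fun i _ hi => by simp [hi.symm]) (by simp)]
      simp
    · exact Finset.sum_congr rfl fun i _ => by ring

theorem differentiable_polyFun (p : MvPolynomial (Fin d) ℝ) : Differentiable ℝ (polyFun p) :=
  fun x => (hasFDerivAt_polyFun p x).differentiableAt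

theorem fderiv_polyFun (p : MvPolynomial (Fin d) ℝ) (x v : E d) :
    fderiv ℝ (polyFun p) x v = ∑ i, polyFun (MvPolynomial.pderiv i p) x * v i := by
  rw [(hasFDerivAt_polyFun p x).fderiv]
  simp

theorem gradient_polyFun_coord (p : MvPolynomial (Fin d) ℝ) (x : E d) (i : Fin d) :
    gradient (polyFun p) x i = polyFun (MvPolynomial.pderiv i p) x := by
  have h : inner ℝ (gradient (polyFun p) x) (EuclideanSpace.single i (1 : ℝ)) =
      fderiv ℝ (polyFun p) x (EuclideanSpace.single i 1) := by
    rw [gradient, InnerProductSpace.toDual_symm_apply]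
  rw [fderiv_polyFun, EuclideanSpace.inner_single_right] at h
  simpa [Pi.single_apply] using h

theorem gradient_polyFun_sub (p q : MvPolynomial (Fin d) ℝ) (x : E d) :
    gradient (polyFun (p - q)) x = gradient (polyFun p) x - gradient (polyFun q) x := by
  ext i
  simp [gradient_polyFun_coord, polyFun_sub]

theorem continuous_gradient_polyFun (p : MvPolynomial (Fin d) ℝ) :
    Continuous (gradient (polyFun p)) := by
  have h : gradient (polyFun p) =
      fun x => WithLp.toLp 2 fun i => polyFun (MvPolynomial.pderiv i p) x := by
    ext x i
    exact gradient_polyFun_coord p x i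
  rw [h]
  have := fun i => continuous_polyFun (MvPolynomial.pderiv i p)
  fun_prop

theorem hasFDerivAt_gradient_polyFun (p : MvPolynomial (Fin d) ℝ) (x : E d) :
    DifferentiableAt ℝ (gradient (polyFun p)) x ∧ ∀ v i, fderiv ℝ (gradient (polyFun p)) x v i =
      fderiv ℝ (polyFun (MvPolynomial.pderiv i p)) x v := by
  have hd : DifferentiableAt ℝ (gradient (polyFun p)) x := by
    rw [differentiableAt_euclidean]
    intro i
    simp only [gradient_polyFun_coord]
    exact differentiable_polyFun _ x
  refine ⟨hd, fun v i => ?_⟩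
  have h := ((EuclideanSpace.proj i : E d →L[ℝ] ℝ).hasFDerivAt.comp x hd.hasFDerivAt).fderiv
  have h2 : (EuclideanSpace.proj i : E d →L[ℝ] ℝ) ∘ gradient (polyFun p) =
      polyFun (MvPolynomial.pderiv i p) := by
    ext y
    exact gradient_polyFun_coord p y i
  rw [h2] at h
  rw [h]
  rfl

theorem totalDegree_pderiv_le (i : Fin d) (p : MvPolynomial (Fin d) ℝ) :
    (MvPolynomial.pderiv i p).totalDegree ≤ p.totalDegree := by
  conv_lhs => rw [p.as_sum, map_sum]
  refine MvPolynomial.totalDegree_finsetSum_le fun s hs => ?_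
  rw [MvPolynomial.pderiv_monomial]
  refine (MvPolynomial.totalDegree_monomial_le _ _).trans
    (le_trans ?_ (MvPolynomial.le_totalDegree hs))
  rw [Finsupp.sum_fintype _ _ (by simp), Finsupp.sum_fintype _ _ (by simp)]
  exact Finset.sum_le_sum fun j _ => by simp

/-- The pullback of a polynomial to the reference simplex of the vertex tuple `y`. -/
def pullback (y : Fin (d + 1) → E d) (p : MvPolynomial (Fin d) ℝ) : MvPolynomial (Fin d) ℝ :=
  MvPolynomial.aeval (fun i => MvPolynomial.C (y 0 i) +
    ∑ j, MvPolynomial.C (edgeMatrix y i j) * MvPolynomial.X j) p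

theorem polyFun_pullback (y : Fin (d + 1) → E d) (p : MvPolynomial (Fin d) ℝ) (z : E d) :
    polyFun (pullback y p) z = polyFun p (y 0 + edgeMap y z) := by
  rw [polyFun, polyFun, pullback, MvPolynomial.aeval_def, MvPolynomial.eval_eval₂,
    MvPolynomial.eval, MvPolynomial.coe_eval₂Hom]
  congr 1
  · ext a
    simp
  · ext1 i
    simp [edgeMap_coord, Matrix.mulVec, dotProduct]

theorem totalDegree_pullback_le (y : Fin (d + 1) → E d) (p : MvPolynomial (Fin d) ℝ) :
    (pullback y p).totalDegree ≤ p.totalDegree := by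
  conv_lhs => rw [pullback, p.as_sum, map_sum]
  refine MvPolynomial.totalDegree_finsetSum_le fun s hs => ?_
  rw [MvPolynomial.aeval_monomial]
  refine le_trans ?_ (MvPolynomial.le_totalDegree hs)
  have h1 : ∀ i, (MvPolynomial.C (y 0 i) + ∑ j, MvPolynomial.C (edgeMatrix y i j) *
      (MvPolynomial.X j : MvPolynomial (Fin d) ℝ)).totalDegree ≤ 1 := by
    intro i
    refine (MvPolynomial.totalDegree_add _ _).trans (max_le (by simp) ?_)
    refine MvPolynomial.totalDegree_finsetSum_le fun j _ => ?_
    refine (MvPolynomial.totalDegree_mul _ _).trans ?_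
    simp
  refine (MvPolynomial.totalDegree_mul _ _).trans ?_
  rw [MvPolynomial.algebraMap_eq, MvPolynomial.totalDegree_C, zero_add]
  refine (MvPolynomial.totalDegree_finsetProd _ _).trans ?_
  refine Finset.sum_le_sum fun i _ => (MvPolynomial.totalDegree_pow _ _).trans ?_
  exact (Nat.mul_le_mul_left _ (h1 i)).trans (by simp)

end Polynomial

/-! ### Inverse estimates -/

theorem exists_abs_le_mul_norm_of_injective {V F : Type*} [AddCommGroup V] [Module ℝ V]
    [FiniteDimensional ℝ V] [NormedAddCommGroup F] [NormedSpace ℝ F] (Φ : V →ₗ[ℝ] F)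
    (hΦ : Function.Injective Φ) (l : V →ₗ[ℝ] ℝ) : ∃ C : ℝ, 0 ≤ C ∧ ∀ v, |l v| ≤ C * ‖Φ v‖ := by
  let e := LinearEquiv.ofInjective Φ hΦ
  let L : LinearMap.range Φ →L[ℝ] ℝ := LinearMap.toContinuousLinearMap (l ∘ₗ e.symm.toLinearMap)
  refine ⟨‖L‖, L.opNorm_nonneg, fun v => ?_⟩
  have h := L.le_opNorm (e v)
  have hL : L (e v) = l v := by simp [L]
  rw [hL] at h
  exact h

theorem memLp_two_of_continuous {d : ℕ} {F : Type*} [NormedAddCommGroup F] {K : Set (E d)}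
    (hK : IsCompact K) {f : E d → F} (hf : Continuous f) : MemLp f 2 (volume.restrict K) := by
  obtain ⟨C, hC⟩ := hK.exists_bound_of_continuousOn hf.continuousOn
  have : IsFiniteMeasure (volume.restrict K) := isFiniteMeasure_restrict.2 hK.measure_lt_top.ne
  exact MemLp.of_bound hf.aestronglyMeasurable C (ae_restrict_of_forall_mem hK.measurableSet hC)

theorem memLp_polyFun {d : ℕ} {K : Set (E d)} (hK : IsCompact K) (p : MvPolynomial (Fin d) ℝ) :
    MemLp (polyFun p) 2 (volume.restrict K) :=
  memLp_two_of_continuous hK (continuous_polyFun p)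

/-- All norms on the polynomials of degree at most `n` are equivalent: the `L²` norm on the
reference simplex controls the values and the first derivatives there. -/
theorem exists_refSimplex_inverse_estimate (d n : ℕ) : ∃ C : ℝ, 0 < C ∧
    ∀ p : MvPolynomial (Fin d) ℝ, p.totalDegree ≤ n → ∀ z ∈ refSimplex d,
      |polyFun p z| ≤ C * (eLpNorm (polyFun p) 2 (volume.restrict (refSimplex d))).toReal ∧
      ∀ i, |polyFun (MvPolynomial.pderiv i p) z| ≤
        C * (eLpNorm (polyFun p) 2 (volume.restrict (refSimplex d))).toReal := by
  let V := MvPolynomial.restrictTotalDegree (Fin d) ℝ n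
  let Φ : V →ₗ[ℝ] Lp ℝ 2 (volume.restrict (refSimplex d)) :=
    { toFun := fun p => (memLp_polyFun (isCompact_refSimplex d) p.1).toLp
      map_add' := fun p q => by
        rw [← MemLp.toLp_add]
        exact MemLp.toLp_congr _ _ (by rw [← polyFun_add]; rfl)
      map_smul' := fun c p => by
        rw [RingHom.id_apply, ← MemLp.toLp_const_smul]
        exact MemLp.toLp_congr _ _ (by rw [← polyFun_smul]; rfl) }
  have hΦn : ∀ p : V, ‖Φ p‖ =
      (eLpNorm (polyFun p.1) 2 (volume.restrict (refSimplex d))).toReal := fun p =>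
    Lp.norm_toLp _ (memLp_polyFun (isCompact_refSimplex d) p.1)
  have hΦ : Function.Injective Φ := by
    rw [injective_iff_map_eq_zero]
    intro p hp
    have h1 : polyFun p.1 =ᵐ[volume.restrict (refSimplex d)] fun _ => (0 : ℝ) := by
      have h2 := (memLp_polyFun (isCompact_refSimplex d) p.1).coeFn_toLp
      have h3 : (memLp_polyFun (isCompact_refSimplex d) p.1).toLp = 0 := hp
      rw [h3] at h2
      exact h2.symm.trans (Lp.coeFn_zero _ _ _)
    have h4 : Set.EqOn (polyFun p.1) (fun _ => (0 : ℝ)) (interior (refSimplex d)) :=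
      Measure.eqOn_open_of_ae_eq (ae_restrict_of_ae_restrict_of_subset interior_subset h1)
        isOpen_interior (continuous_polyFun _).continuousOn continuousOn_const
    obtain ⟨z₀, hz₀⟩ := nonempty_interior_refSimplex d
    have h5 : polyFun p.1 = fun _ => (0 : ℝ) :=
      (analyticOnNhd_polyFun p.1).eq_of_eventuallyEq analyticOnNhd_const
        (h4.eventuallyEq_of_mem (isOpen_interior.mem_nhds hz₀))
    apply Subtype.ext
    apply MvPolynomial.funext
    intro x
    have h6 := congrFun h5 (WithLp.toLp 2 x)
    simpa [polyFun] using h6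
  let b := Module.finBasis ℝ V
  choose c hc0 hc using fun k => exists_abs_le_mul_norm_of_injective Φ hΦ (b.coord k)
  have hbd : ∀ q : MvPolynomial (Fin d) ℝ, ∃ M : ℝ, 0 ≤ M ∧
      ∀ z ∈ refSimplex d, |polyFun q z| ≤ M := by
    intro q
    obtain ⟨M, hM⟩ := (isCompact_refSimplex d).exists_bound_of_continuousOn
      (continuous_polyFun q).continuousOn
    exact ⟨max M 0, le_max_right _ _, fun z hz => (hM z hz).trans (le_max_left _ _)⟩
  -- every linear image of the basis is bounded on the compact reference simplex
  have hmain : ∀ S : MvPolynomial (Fin d) ℝ →ₗ[ℝ] MvPolynomial (Fin d) ℝ, ∃ C : ℝ, 0 ≤ C ∧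
      ∀ p : V, ∀ z ∈ refSimplex d, |polyFun (S p.1) z| ≤ C * ‖Φ p‖ := by
    intro S
    choose M hM0 hM using fun k => hbd (S (b k).1)
    refine ⟨∑ k, c k * M k, Finset.sum_nonneg fun k _ => mul_nonneg (hc0 k) (hM0 k), ?_⟩
    intro p z hz
    have hp : p.1 = ∑ k, b.coord k p • (b k).1 := by
      have h := congrArg Subtype.val (b.sum_repr p)
      rw [Submodule.coe_sum] at h
      exact h.symm
    have hpz : polyFun (S p.1) z = ∑ k, b.coord k p * polyFun (S (b k).1) z := by
      conv_lhs => rw [hp]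
      simp [polyFun]
    rw [hpz, Finset.sum_mul]
    refine (Finset.abs_sum_le_sum_abs _ _).trans (Finset.sum_le_sum fun k _ => ?_)
    rw [abs_mul]
    calc |b.coord k p| * |polyFun (S (b k).1) z| ≤ (c k * ‖Φ p‖) * M k :=
          mul_le_mul (hc k p) (hM k z hz) (abs_nonneg _) (mul_nonneg (hc0 k) (norm_nonneg _))
      _ = _ := by ring
  obtain ⟨C₀, hC₀, h0⟩ := hmain LinearMap.id
  choose C₁ hC₁ h1 using fun i : Fin d => hmain (MvPolynomial.pderiv i).toLinearMap
  have hsum : 0 ≤ ∑ i, C₁ i := Finset.sum_nonneg fun i _ => hC₁ i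
  refine ⟨C₀ + ∑ i, C₁ i + 1, by positivity, fun p hp z hz => ?_⟩
  have hpV : p ∈ V := (MvPolynomial.mem_restrictTotalDegree _ _ _).2 hp
  have hN := hΦn ⟨p, hpV⟩
  rw [← hN]
  refine ⟨(h0 ⟨p, hpV⟩ z hz).trans ?_, fun i => (h1 i ⟨p, hpV⟩ z hz).trans ?_⟩
  · gcongr
    linarith
  · gcongr
    linarith [Finset.single_le_sum (fun i _ => hC₁ i) (Finset.mem_univ i)]

theorem hasFDerivAt_add_edgeMap {d : ℕ} (y : Fin (d + 1) → E d) (z : E d) :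
    HasFDerivAt (fun z => y 0 + edgeMap y z) (edgeMap y) z :=
  (edgeMap y).hasFDerivAt.const_add _

theorem bijective_edgeMap {d : ℕ} {y : Fin (d + 1) → E d} (hy : 0 < |(edgeMatrix y).det|) :
    Function.Bijective (edgeMap y) := by
  have h : LinearMap.det (edgeMap y : E d →ₗ[ℝ] E d) ≠ 0 := by
    rw [det_edgeMap]
    exact abs_pos.1 hy
  exact (LinearMap.equivOfDetNeZero (edgeMap y : E d →ₗ[ℝ] E d) h).bijective

/-- Change of variables to the reference simplex. -/
theorem eLpNorm_polyFun_eq_pullback {d : ℕ} [NeZero d] (T : Elem d) (q : MvPolynomial (Fin d) ℝ) :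
    (eLpNorm (polyFun q) 2 (volume.restrict T.closedInterior)).toReal =
      √|(edgeMatrix T.points).det| *
        (eLpNorm (polyFun (pullback T.points q)) 2 (volume.restrict (refSimplex d))).toReal := by
  have hinj : Set.InjOn (fun z => T.points 0 + edgeMap T.points z) (refSimplex d) :=
    fun a _ b _ h => (bijective_edgeMap (abs_det_pos T)).1 (add_left_cancel h)
  rw [eLpNorm_two_eq, eLpNorm_two_eq, ← T.convexHull_eq_closedInterior, convexHull_range_eq_image,
    lintegral_image_eq_lintegral_abs_det_fderiv_mul volume (isCompact_refSimplex d).measurableSet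
      (fun z _ => (hasFDerivAt_add_edgeMap T.points z).hasFDerivWithinAt) hinj,
    lintegral_const_mul' _ _ ENNReal.ofReal_ne_top, ENNReal.mul_rpow_of_nonneg _ _ (by norm_num),
    ENNReal.toReal_mul, ← ENNReal.toReal_rpow, ENNReal.toReal_ofReal (abs_nonneg _),
    Real.sqrt_eq_rpow]
  congr 2
  · rw [ContinuousLinearMap.det, det_edgeMap]
  · simp only [polyFun_pullback]

/-- Inverse estimates on a shape regular simplex, by scaling to the reference simplex. -/
theorem exists_inverse_estimate (d : ℕ) [NeZero d] (n : ℕ) {s : ℝ} (hs : 0 < s) : ∃ C : ℝ, 0 < C ∧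
    ∀ T : Elem d, Metric.diam T.closedInterior ≤ s * meshSize T →
    ∀ q : MvPolynomial (Fin d) ℝ, q.totalDegree ≤ n → ∀ x ∈ T.closedInterior,
      |polyFun q x| * √(volume.real T.closedInterior) ≤
        C * (eLpNorm (polyFun q) 2 (volume.restrict T.closedInterior)).toReal ∧
      ∀ i, meshSize T * |polyFun (MvPolynomial.pderiv i q) x| * √(volume.real T.closedInterior) ≤
        C * (eLpNorm (polyFun q) 2 (volume.restrict T.closedInterior)).toReal := by
  obtain ⟨C, hC, hCp⟩ := exists_refSimplex_inverse_estimate d n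
  set κ := volume.real (refSimplex d) with hκdef
  have hκ : 0 < κ := volume_real_refSimplex_pos d
  set c := κ * d * d.factorial * s ^ (d - 1) with hc
  have hc0 : 0 ≤ c := by positivity
  refine ⟨C * √κ * (1 + d * c), by positivity, ?_⟩
  intro T hT q hq x hx
  rw [← T.convexHull_eq_closedInterior, convexHull_range_eq_image] at hx
  obtain ⟨z, hz, rfl⟩ := hx
  have hp := hCp (pullback T.points q) ((totalDegree_pullback_le _ _).trans hq) z hz
  have hvol : √(volume.real T.closedInterior) = √|(edgeMatrix T.points).det| * √κ := by
    rw [← T.convexHull_eq_closedInterior, volume_convexHull_range, Real.sqrt_mul (abs_nonneg _)]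
  rw [hvol, eLpNorm_polyFun_eq_pullback]
  set N := (eLpNorm (polyFun (pullback T.points q)) 2 (volume.restrict (refSimplex d))).toReal
  have hN : 0 ≤ N := ENNReal.toReal_nonneg
  set δ := √|(edgeMatrix T.points).det|
  have hδ : 0 ≤ δ := Real.sqrt_nonneg _
  have hh := meshSize_pos T
  constructor
  · have h1 := hp.1
    rw [polyFun_pullback] at h1
    calc |polyFun q (T.points 0 + edgeMap T.points z)| * (δ * √κ) ≤ (C * N) * (δ * √κ) := by gcongr
      _ = C * √κ * 1 * (δ * N) := by ring
      _ ≤ C * √κ * (1 + d * c) * (δ * N) := by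
        gcongr
        have : 0 ≤ d * c := by positivity
        linarith
  · intro i
    obtain ⟨ζ, hζ⟩ := (bijective_edgeMap (abs_det_pos T)).2 (EuclideanSpace.single i 1)
    have hζn : meshSize T * ‖ζ‖ ≤ c := by
      have h := norm_le_of_shapeRegular T hs hT ζ
      rw [hζ] at h
      simpa using h
    have hchain : polyFun (MvPolynomial.pderiv i q) (T.points 0 + edgeMap T.points z) =
        ∑ j, polyFun (MvPolynomial.pderiv j (pullback T.points q)) z * ζ j := by
      rw [← fderiv_polyFun]
      have h1 : polyFun (pullback T.points q) =
          polyFun q ∘ fun z => T.points 0 + edgeMap T.points z := by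
        ext z
        exact polyFun_pullback _ _ _
      rw [h1, ((differentiable_polyFun q _).hasFDerivAt.comp z
        (hasFDerivAt_add_edgeMap T.points z)).fderiv, ContinuousLinearMap.comp_apply, hζ,
        fderiv_polyFun]
      simp
    have hbound : |polyFun (MvPolynomial.pderiv i q) (T.points 0 + edgeMap T.points z)| ≤
        d * (C * N * ‖ζ‖) := by
      rw [hchain]
      calc |∑ j, polyFun (MvPolynomial.pderiv j (pullback T.points q)) z * ζ j|
          ≤ ∑ j, |polyFun (MvPolynomial.pderiv j (pullback T.points q)) z * ζ j| :=
            Finset.abs_sum_le_sum_abs _ _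
        _ ≤ ∑ _j : Fin d, C * N * ‖ζ‖ := by
            refine Finset.sum_le_sum fun j _ => ?_
            rw [abs_mul]
            exact mul_le_mul (hp.2 j) (abs_coord_le_norm ζ j) (abs_nonneg _) (by positivity)
        _ = d * (C * N * ‖ζ‖) := by simp
    calc meshSize T * |polyFun (MvPolynomial.pderiv i q) (T.points 0 + edgeMap T.points z)| *
          (δ * √κ)
        ≤ meshSize T * (d * (C * N * ‖ζ‖)) * (δ * √κ) := by gcongr
      _ = C * √κ * (d * (meshSize T * ‖ζ‖)) * (δ * N) := by ring
      _ ≤ C * √κ * (1 + d * c) * (δ * N) := by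
        gcongr
        have : (d : ℝ) * (meshSize T * ‖ζ‖) ≤ d * c := by gcongr
        linarith

/-! ### Hausdorff measure of faces -/

theorem norm_edgeMap_le {k d : ℕ} (y : Fin (k + 1) → E d) {D : ℝ}
    (hy : ∀ j : Fin k, ‖y j.succ - y 0‖ ≤ D) (z : E k) : ‖edgeMap y z‖ ≤ k * D * ‖z‖ := by
  rw [edgeMap_apply]
  calc ‖∑ j, z j • (y j.succ - y 0)‖ ≤ ∑ j, ‖z j • (y j.succ - y 0)‖ := norm_sum_le _ _
    _ ≤ ∑ _j : Fin k, D * ‖z‖ := by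
        refine Finset.sum_le_sum fun j _ => ?_
        rw [norm_smul, mul_comm]
        exact mul_le_mul (hy j) (abs_coord_le_norm z j) (norm_nonneg _)
          ((norm_nonneg _).trans (hy j))
    _ = k * D * ‖z‖ := by simp; ring

/-- A `k`-simplex is a Lipschitz image of the reference simplex of `ℝᵏ`. -/
theorem euclideanHausdorffMeasure_closedInterior_le {k d : ℕ} (F : Affine.Simplex ℝ (E d) k)
    {D : ℝ} (hD : 0 ≤ D) (hF : ∀ i j, dist (F.points i) (F.points j) ≤ D) :
    (μHE[k] : Measure (E d)) F.closedInterior ≤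
      ENNReal.ofReal ((k * D) ^ k * volume.real (refSimplex k)) := by
  have hlip : LipschitzWith (Real.toNNReal (k * D))
      fun z : E k => F.points 0 + edgeMap F.points z := by
    refine LipschitzWith.of_dist_le_mul fun z w => ?_
    rw [dist_eq_norm, dist_eq_norm, add_sub_add_left_eq_sub, ← map_sub,
      Real.coe_toNNReal _ (by positivity)]
    exact norm_edgeMap_le _ (fun j => by rw [← dist_eq_norm]; exact hF _ _) _
  have hvol : (μHE[k] : Measure (E k)) (refSimplex k) = volume (refSimplex k) := by
    rw [EuclideanSpace.euclideanHausdorffMeasure_eq_volume]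
  rw [← F.convexHull_eq_closedInterior, convexHull_range_eq_image,
    ENNReal.ofReal_mul (by positivity), Measure.real,
    ENNReal.ofReal_toReal (volume_refSimplex_lt_top k).ne, ← hvol,
    ENNReal.ofReal_pow (by positivity)]
  have h := hlip.hausdorffMeasure_image_le (d := k) (Nat.cast_nonneg k) (refSimplex k)
  rw [Measure.euclideanHausdorffMeasure_def, Measure.euclideanHausdorffMeasure_def,
    Measure.smul_apply, Measure.smul_apply, ENNReal.smul_def, ENNReal.smul_def,
    smul_eq_mul, smul_eq_mul, mul_left_comm]
  gcongr
  rw [ENNReal.rpow_natCast] at h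
  exact h

/-! ### Geometry of patches -/

namespace Triangulation
variable {d : ℕ} [NeZero d] {Ω : Set (E d)} (𝒯 : Triangulation d Ω)

theorem disjoint_interior {S T : Elem d} (hS : S ∈ 𝒯.elems) (hT : T ∈ 𝒯.elems) (hST : S ≠ T) :
    Disjoint S.interior T.interior := by
  rw [Set.disjoint_left]
  intro x hxS hxT
  have hx : x ∈ convexHull ℝ (Set.range S.points ∩ Set.range T.points) := by
    rw [← 𝒯.conforming S hS T hT hST]
    exact ⟨S.interior_subset_closedInterior hxS, T.interior_subset_closedInterior hxT⟩
  -- some vertex of `S` is not a vertex of `T`, so `x` lies in the opposite face of `S`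
  have hex : ∃ i, S.points i ∉ Set.range T.points := by
    by_contra! hall
    have hsub : Set.range S.points ⊆ Set.range T.points := by
      rintro _ ⟨i, rfl⟩
      exact hall i
    refine 𝒯.vertices_ne S hS T hT hST (Set.eq_of_subset_of_ncard_le hsub ?_ (Set.finite_range _))
    rw [← Set.image_univ, ← Set.image_univ, Set.ncard_image_of_injective _ S.independent.injective,
      Set.ncard_image_of_injective _ T.independent.injective]
  obtain ⟨i, hi⟩ := hex
  have hxi : x ∈ (S.faceOpposite i).closedInterior := by
    rw [← (S.faceOpposite i).convexHull_eq_closedInterior]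
    refine convexHull_mono ?_ hx
    rintro _ ⟨⟨j, rfl⟩, hj⟩
    rw [S.range_faceOpposite_points]
    exact ⟨j, fun hji => hi (by rw [← show j = i from hji]; exact hj), rfl⟩
  exact Set.disjoint_left.1 (S.disjoint_interior_closedInterior_faceOpposite i) hxS hxi

variable {𝒯}

theorem mem_neighbors {T T' : Elem d} {i : Fin (d + 1)} : T' ∈ 𝒯.neighbors T i ↔
    T' ∈ 𝒯.elems ∧ T.closedInterior ∩ T'.closedInterior = (T.faceOpposite i).closedInterior := by
  simp [neighbors]

theorem ne_of_mem_neighbors {T T' : Elem d} {i : Fin (d + 1)} (h : T' ∈ 𝒯.neighbors T i) :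
    T ≠ T' := by
  rintro rfl
  have h1 := (mem_neighbors.1 h).2
  rw [Set.inter_self] at h1
  exact (T.closedInterior_faceOpposite_ssubset_closedInterior i).ne h1.symm

/-- Neighbouring elements share an edge. -/
theorem exists_common_vertices (hd : 2 ≤ d) {T T' : Elem d} (hT : T ∈ 𝒯.elems) {i : Fin (d + 1)}
    (h : T' ∈ 𝒯.neighbors T i) : ∃ j k j' k', j ≠ k ∧ j' ≠ k' ∧
      T.points j = T'.points j' ∧ T.points k = T'.points k' := by
  obtain ⟨hT', hface⟩ := mem_neighbors.1 h
  have hne := ne_of_mem_neighbors h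
  rw [𝒯.conforming T hT T' hT' hne] at hface
  have hnt : (Set.range T.points ∩ Set.range T'.points).Nontrivial := by
    rw [← Set.not_subsingleton_iff]
    intro hsub
    have hss : (T.faceOpposite i).closedInterior.Subsingleton := by
      rw [← hface]
      rcases hsub.eq_empty_or_singleton with h0 | ⟨p, h0⟩ <;> simp [h0]
    have h01 := hss ((T.faceOpposite i).point_mem_closedInterior 0)
      ((T.faceOpposite i).point_mem_closedInterior (Fin.last (d - 1)))
    have := (T.faceOpposite i).independent.injective h01
    have := congrArg Fin.val this
    simp at this
    omega
  obtain ⟨_, ⟨⟨j, rfl⟩, ⟨j', hj'⟩⟩, _, ⟨⟨k, rfl⟩, ⟨k', hk'⟩⟩, hjk⟩ := hnt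
  refine ⟨j, k, j', k', fun h => hjk (by rw [h]), fun h => hjk (by rw [← hj', ← hk', h]),
    hj'.symm, hk'.symm⟩

/-- The constant comparing the mesh sizes of neighbours. -/
def neighborConst (d : ℕ) (s : ℝ) : ℝ :=
  volume.real (refSimplex d) * d * d.factorial * s ^ (d - 1) * s

theorem neighborConst_pos (d : ℕ) [NeZero d] {s : ℝ} (hs : 0 < s) : 0 < neighborConst d s := by
  have := volume_real_refSimplex_pos d
  have : (0 : ℝ) < d := by exact_mod_cast NeZero.pos d
  unfold neighborConst
  positivity

theorem meshSize_le_of_common_vertices {s : ℝ} (hs : 0 < s) (hreg : 𝒯.ShapeRegular s)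
    {T T' : Elem d} (hT : T ∈ 𝒯.elems) (hT' : T' ∈ 𝒯.elems) {j k j' k' : Fin (d + 1)} (hjk : j ≠ k)
    (hj : T.points j = T'.points j') (hk : T.points k = T'.points k') :
    meshSize T ≤ neighborConst d s * meshSize T' := by
  have hκ := volume_real_refSimplex_pos d
  calc meshSize T ≤ volume.real (refSimplex d) * d * d.factorial * s ^ (d - 1) *
        dist (T.points j) (T.points k) := meshSize_le_edge T hs (hreg T hT) hjk
    _ ≤ volume.real (refSimplex d) * d * d.factorial * s ^ (d - 1) * (s * meshSize T') := by
        gcongr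
        rw [hj, hk]
        exact (dist_le_diam T' (T'.point_mem_closedInterior _)
          (T'.point_mem_closedInterior _)).trans (hreg T' hT')
    _ = neighborConst d s * meshSize T' := by rw [neighborConst]; ring

theorem meshSize_le_neighbor (hd : 2 ≤ d) {s : ℝ} (hs : 0 < s) (hreg : 𝒯.ShapeRegular s)
    {T T' : Elem d} (hT : T ∈ 𝒯.elems) {i : Fin (d + 1)} (h : T' ∈ 𝒯.neighbors T i) :
    meshSize T ≤ neighborConst d s * meshSize T' := by
  obtain ⟨j, k, j', k', hjk, hjk', hj, hk⟩ := exists_common_vertices hd hT h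
  exact meshSize_le_of_common_vertices hs hreg hT (mem_neighbors.1 h).1 hjk hj hk

theorem neighbor_meshSize_le (hd : 2 ≤ d) {s : ℝ} (hs : 0 < s) (hreg : 𝒯.ShapeRegular s)
    {T T' : Elem d} (hT : T ∈ 𝒯.elems) {i : Fin (d + 1)} (h : T' ∈ 𝒯.neighbors T i) :
    meshSize T' ≤ neighborConst d s * meshSize T := by
  obtain ⟨j, k, j', k', hjk, hjk', hj, hk⟩ := exists_common_vertices hd hT h
  exact meshSize_le_of_common_vertices hs hreg (mem_neighbors.1 h).1 hT hjk' hj.symm hk.symm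

/-- The number of neighbours across a face is bounded: they have disjoint interiors, comparable
volumes and lie in a ball of comparable radius. -/
theorem card_neighbors_le (hd : 2 ≤ d) {s : ℝ} (hs : 0 < s) (hreg : 𝒯.ShapeRegular s)
    {T : Elem d} (hT : T ∈ 𝒯.elems) (i : Fin (d + 1)) :
    ((𝒯.neighbors T i).card : ℝ) ≤ neighborConst d s ^ d *
      ((s + s * neighborConst d s) ^ d * volume.real (Metric.ball (0 : E d) 1)) := by
  set c := neighborConst d s
  have hc : 0 < c := neighborConst_pos d hs
  have hh := meshSize_pos T
  set r := (s + s * c) * meshSize T with hr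
  have hr0 : 0 < r := by positivity
  have hsub : (⋃ T' ∈ 𝒯.neighbors T i, T'.interior) ⊆ Metric.closedBall (T.points 0) r := by
    intro x hx
    simp only [Set.mem_iUnion] at hx
    obtain ⟨T', hT', hx⟩ := hx
    obtain ⟨j, k, j', k', -, -, hj, -⟩ := exists_common_vertices hd hT hT'
    have h1 := (dist_le_diam T' (T'.interior_subset_closedInterior hx)
      (T'.point_mem_closedInterior j')).trans (hreg T' (mem_neighbors.1 hT').1)
    have h2 := (dist_le_diam T (T.point_mem_closedInterior j)
      (T.point_mem_closedInterior 0)).trans (hreg T hT)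
    have h3 : s * meshSize T' ≤ s * (c * meshSize T) := by
      gcongr
      exact neighbor_meshSize_le hd hs hreg hT hT'
    rw [Metric.mem_closedBall]
    calc dist x (T.points 0) ≤ dist x (T'.points j') + dist (T'.points j') (T.points 0) :=
          dist_triangle _ _ _
      _ ≤ r := by rw [← hj, hr] at *; linarith
  have hvol : ∑ T' ∈ 𝒯.neighbors T i, volume.real T'.interior =
      volume.real (⋃ T' ∈ 𝒯.neighbors T i, T'.interior) := by
    rw [measureReal_biUnion_finset ?_ ?_ fun S _ =>
      ((measure_mono S.interior_subset_closedInterior).trans_lt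
        (volume_closedInterior_lt_top S)).ne]
    · intro S hS S' hS' hne
      exact 𝒯.disjoint_interior (mem_neighbors.1 hS).1 (mem_neighbors.1 hS').1 hne
    · exact fun S _ => (isOpen_simplex_interior S).measurableSet
  have hball : volume.real (Metric.closedBall (T.points 0) r) =
      r ^ d * volume.real (Metric.ball (0 : E d) 1) := by
    rw [Measure.real, Measure.addHaar_closedBall _ _ hr0.le, ENNReal.toReal_mul,
      ENNReal.toReal_ofReal (by positivity), finrank_euclideanSpace_fin, Measure.real]
  have hle : ∑ T' ∈ 𝒯.neighbors T i, volume.real T'.interior ≤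
      r ^ d * volume.real (Metric.ball (0 : E d) 1) := by
    rw [hvol, ← hball]
    exact measureReal_mono hsub measure_closedBall_lt_top.ne
  have hlow : ∀ T' ∈ 𝒯.neighbors T i, (meshSize T / c) ^ d ≤ volume.real T'.interior := by
    intro T' hT'
    rw [measureReal_congr (simplex_interior_ae_eq T'), ← meshSize_pow]
    gcongr
    rw [div_le_iff₀' hc]
    exact meshSize_le_neighbor hd hs hreg hT hT'
  have hfin := (Finset.card_nsmul_le_sum _ _ _ hlow).trans hle
  rw [nsmul_eq_mul, div_pow, hr, mul_pow, mul_div_assoc', div_le_iff₀ (by positivity)] at hfin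
  have hpos : 0 < meshSize T ^ d := by positivity
  refine le_of_mul_le_mul_right ?_ hpos
  linarith

end Triangulation

/-! ### Norms on patches -/

namespace Triangulation
theorem isBounded_domain {d : ℕ} {Ω : Set (E d)} (𝒯 : Triangulation d Ω) :
    Bornology.IsBounded Ω := by
  refine Bornology.IsBounded.subset ?_ subset_closure
  rw [← 𝒯.cover, Bornology.isBounded_biUnion_finset]
  exact fun T _ => T.isCompact_closedInterior.isBounded

variable {d : ℕ} [NeZero d] {Ω : Set (E d)} {𝒯 : Triangulation d Ω}

theorem ae_closedInterior_of_ae {T : Elem d} (hT : T ∈ 𝒯.elems) {P : E d → Prop}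
    (h : ∀ᵐ x ∂volume.restrict Ω, P x) : ∀ᵐ x ∂volume.restrict T.closedInterior, P x := by
  rw [← Measure.restrict_congr_set (simplex_interior_ae_eq T)]
  exact ae_restrict_of_ae_restrict_of_subset (𝒯.interior_subset T hT) h

theorem closedInterior_subset_patch (T : Elem d) : T.closedInterior ⊆ 𝒯.patch T :=
  Set.subset_union_left

theorem neighbor_subset_patch {T T' : Elem d} {i : Fin (d + 1)} (h : T' ∈ 𝒯.neighbors T i) :
    T'.closedInterior ⊆ 𝒯.patch T := fun _ hx =>
  Or.inr (Set.mem_iUnion.2 ⟨i, Set.mem_iUnion₂.2 ⟨T', h, hx⟩⟩)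

theorem patch_subset {T : Elem d} (hT : T ∈ 𝒯.elems) : 𝒯.patch T ⊆ closure Ω := by
  have h : ∀ S ∈ 𝒯.elems, S.closedInterior ⊆ closure Ω := fun S hS => by
    rw [← 𝒯.cover]
    exact Set.subset_iUnion₂_of_subset S hS subset_rfl
  refine Set.union_subset (h T hT) (Set.iUnion_subset fun i => Set.iUnion₂_subset fun S hS => ?_)
  exact h S (mem_neighbors.1 hS).1

theorem volume_patch_lt_top {T : Elem d} (hT : T ∈ 𝒯.elems) : volume (𝒯.patch T) < ⊤ :=
  (measure_mono (patch_subset hT)).trans_lt 𝒯.isBounded_domain.closure.measure_lt_top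

theorem sum_indicator_eq {F : Type*} [AddCommMonoid F] (f : Elem d → E d → F) {T : Elem d}
    (hT : T ∈ 𝒯.elems) {x : E d} (hx : x ∈ T.interior) :
    ∑ S ∈ 𝒯.elems, S.interior.indicator (f S) x = f T x := by
  rw [Finset.sum_eq_single_of_mem T hT, Set.indicator_of_mem hx]
  intro S hS hST
  exact Set.indicator_of_notMem
    (fun h => Set.disjoint_left.1 (𝒯.disjoint_interior hS hT hST) h hx) _

theorem pwFun_eq (v : Piecewise d) {T : Elem d} (hT : T ∈ 𝒯.elems) {x : E d}
    (hx : x ∈ T.interior) : 𝒯.pwFun v x = polyFun (v T) x :=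
  sum_indicator_eq (fun S => polyFun (v S)) hT hx

theorem ae_mem_interior (T : Elem d) : ∀ᵐ x ∂volume.restrict T.closedInterior, x ∈ T.interior := by
  rw [← Measure.restrict_congr_set (simplex_interior_ae_eq T)]
  exact ae_restrict_mem (isOpen_simplex_interior T).measurableSet

/-- A property that holds in the interiors of all elements holds almost everywhere in a patch. -/
theorem ae_patch_of_interior {T : Elem d} (hT : T ∈ 𝒯.elems) {P : E d → Prop}
    (h : ∀ S ∈ 𝒯.elems, ∀ x ∈ S.interior, P x) : ∀ᵐ x ∂volume.restrict (𝒯.patch T), P x := by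
  have h1 : ∀ S ∈ 𝒯.elems, ∀ᵐ x ∂volume.restrict S.closedInterior, P x := fun S hS =>
    (ae_mem_interior S).mono fun x hx => h S hS x hx
  rw [patch, ae_restrict_union_iff]
  refine ⟨h1 T hT, ?_⟩
  rw [ae_restrict_iUnion_iff]
  intro i
  rw [ae_restrict_biUnion_finset_iff]
  exact fun T' hT' => h1 T' (mem_neighbors.1 hT').1

theorem eLpNorm_sum_indicator_patch_lt_top {F : Type*} [NormedAddCommGroup F]
    (f : Elem d → E d → F) (hf : ∀ S, Continuous (f S)) {T : Elem d} (hT : T ∈ 𝒯.elems) :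
    eLpNorm (fun x => ∑ S ∈ 𝒯.elems, S.interior.indicator (f S) x) 2
      (volume.restrict (𝒯.patch T)) < ⊤ := by
  have hb : ∀ S : Elem d, ∃ M : ℝ, ∀ x ∈ S.closedInterior, ‖f S x‖ ≤ M := fun S =>
    S.isCompact_closedInterior.exists_bound_of_continuousOn (hf S).continuousOn
  choose M hM using hb
  have hbound : ∀ᵐ x ∂volume.restrict (𝒯.patch T),
      ‖∑ S ∈ 𝒯.elems, S.interior.indicator (f S) x‖ ≤ ∑ S ∈ 𝒯.elems, |M S| := by
    refine ae_patch_of_interior hT fun S hS x hx => ?_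
    rw [sum_indicator_eq f hS hx]
    refine ((hM S x (S.interior_subset_closedInterior hx)).trans (le_abs_self _)).trans ?_
    exact Finset.single_le_sum (f := fun S => |M S|) (fun S _ => abs_nonneg _) hS
  have : IsFiniteMeasure (volume.restrict (𝒯.patch T)) :=
    isFiniteMeasure_restrict.2 (volume_patch_lt_top hT).ne
  exact (eLpNorm_le_of_ae_bound hbound).trans_lt (ENNReal.mul_lt_top
    (ENNReal.rpow_lt_top_of_nonneg (by simp) (measure_ne_top _ _)) ENNReal.ofReal_lt_top)

theorem patchNorm_nonneg (v : Piecewise d) (T : Elem d) : 0 ≤ 𝒯.patchNorm v T := Real.sqrt_nonneg _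

/-- The norm of a piecewise function on a patch controls the norm of each of its pieces there. -/
theorem local_norm_le {F : Type*} [NormedAddCommGroup F] (f : Elem d → E d → F)
    (hf : ∀ S, Continuous (f S)) {S T : Elem d} (hT : T ∈ 𝒯.elems) (hS : S ∈ 𝒯.elems)
    (hST : S.closedInterior ⊆ 𝒯.patch T) :
    (eLpNorm (f S) 2 (volume.restrict S.closedInterior)).toReal ≤
      (eLpNorm (fun x => ∑ S ∈ 𝒯.elems, S.interior.indicator (f S) x) 2
        (volume.restrict (𝒯.patch T))).toReal := by
  refine ENNReal.toReal_mono (eLpNorm_sum_indicator_patch_lt_top f hf hT).ne ?_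
  refine le_trans (le_of_eq ?_) (eLpNorm_mono_measure _ (Measure.restrict_mono_set volume hST))
  refine eLpNorm_congr_ae ?_
  filter_upwards [ae_mem_interior S] with x hx
  exact (sum_indicator_eq f hS hx).symm

theorem gradient_norm_le_patchNorm (v : Piecewise d) {S T : Elem d} (hT : T ∈ 𝒯.elems)
    (hS : S ∈ 𝒯.elems) (hST : S.closedInterior ⊆ 𝒯.patch T) :
    (eLpNorm (gradient (polyFun (v S))) 2 (volume.restrict S.closedInterior)).toReal ≤
      𝒯.patchNorm v T := by
  refine (local_norm_le (fun S => gradient (polyFun (v S)))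
    (fun S => continuous_gradient_polyFun _) hT hS hST).trans ?_
  exact Real.le_sqrt_of_sq_le (le_add_of_nonneg_right (sq_nonneg _))

theorem norm_le_patchNorm (v : Piecewise d) {S T : Elem d} (hT : T ∈ 𝒯.elems)
    (hS : S ∈ 𝒯.elems) (hST : S.closedInterior ⊆ 𝒯.patch T) :
    (eLpNorm (polyFun (v S)) 2 (volume.restrict S.closedInterior)).toReal ≤ 𝒯.patchNorm v T := by
  refine (local_norm_le (fun S => polyFun (v S))
    (fun S => continuous_polyFun _) hT hS hST).trans ?_
  exact Real.le_sqrt_of_sq_le (le_add_of_nonneg_left (sq_nonneg _))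

end Triangulation

/-! ### The coefficient matrix -/

theorem eLpNorm_top_lt_top {α F : Type*} [MeasurableSpace α] [NormedAddCommGroup F]
    {μ : Measure α} {f : α → F}
    {M : ℝ} (h : ∀ᵐ x ∂μ, ‖f x‖ ≤ M) : eLpNorm f ⊤ μ < ⊤ := by
  rw [eLpNorm_exponent_top]
  exact eLpNormEssSup_lt_top_of_ae_bound h

theorem ae_norm_le_toReal_eLpNorm_top {α F : Type*} [MeasurableSpace α] [NormedAddCommGroup F]
    {μ : Measure α}
    {f : α → F} (h : eLpNorm f ⊤ μ < ⊤) : ∀ᵐ x ∂μ, ‖f x‖ ≤ (eLpNorm f ⊤ μ).toReal := by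
  rw [eLpNorm_exponent_top] at h ⊢
  filter_upwards [ae_le_eLpNormEssSup (f := f) (μ := μ)] with x hx
  rw [← toReal_enorm]
  exact ENNReal.toReal_mono h.ne hx

theorem exists_bound_coefficient {d : ℕ} {Ω : Set (E d)} {D : ProblemData d}
    (𝒯 : Triangulation d Ω) (hD : D.Admissible Ω) :
    ∃ M : ℝ, ∀ x ∈ Ω, ‖D.A x‖ ≤ M := by
  obtain ⟨L, hL⟩ := hD.lipschitz
  rcases Ω.eq_empty_or_nonempty with h | ⟨x₀, hx₀⟩
  · exact ⟨0, by simp [h]⟩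
  · refine ⟨‖D.A x₀‖ + L * Metric.diam Ω, fun x hx => ?_⟩
    have h1 := hL.dist_le_mul x hx x₀ hx₀
    have h2 := Metric.dist_le_diam_of_mem 𝒯.isBounded_domain hx hx₀
    have h3 : ‖D.A x‖ ≤ ‖D.A x₀‖ + dist (D.A x) (D.A x₀) := by
      rw [dist_eq_norm]
      exact norm_le_norm_add_norm_sub' _ _
    have h4 : (L : ℝ) * dist x x₀ ≤ L * Metric.diam Ω := by gcongr
    linarith

section Coefficient
variable {d : ℕ} [NeZero d] {Ω : Set (E d)} {𝒯 : Triangulation d Ω} {D : ProblemData d}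

theorem ae_norm_coefficient_le (hD : D.Admissible Ω) {T : Elem d} (hT : T ∈ 𝒯.elems) :
    ∀ᵐ x ∂volume.restrict (𝒯.patch T),
      ‖D.A x‖ ≤ (eLpNorm D.A ⊤ (volume.restrict (𝒯.patch T))).toReal := by
  obtain ⟨M, hM⟩ := exists_bound_coefficient 𝒯 hD
  exact ae_norm_le_toReal_eLpNorm_top (eLpNorm_top_lt_top (Triangulation.ae_patch_of_interior hT
    fun S hS x hx => hM x (𝒯.interior_subset S hS hx)))

/-- The coefficient matrix is continuous in `Ω`, so the essential bound on the patch holds at every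
point of the element in `Ω`, in particular on its faces. -/
theorem norm_coefficient_le (hΩ : IsOpen Ω) (hD : D.Admissible Ω) {T : Elem d} (hT : T ∈ 𝒯.elems)
    {x : E d} (hx : x ∈ T.closedInterior) (hxΩ : x ∈ Ω) :
    ‖D.A x‖ ≤ (eLpNorm D.A ⊤ (volume.restrict (𝒯.patch T))).toReal := by
  obtain ⟨L, hL⟩ := hD.lipschitz
  set M := (eLpNorm D.A ⊤ (volume.restrict (𝒯.patch T))).toReal
  by_contra! hlt
  have hcont : ContinuousAt (fun y => ‖D.A y‖) x :=
    (hL.continuousOn.continuousAt (hΩ.mem_nhds hxΩ)).norm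
  obtain ⟨U, hU, hUo, hxU⟩ := mem_nhds_iff.1 (hcont.eventually (lt_mem_nhds hlt))
  have hne : (U ∩ T.interior).Nonempty := by
    rw [← closure_simplex_interior T] at hx
    exact mem_closure_iff.1 hx U hUo hxU
  have hpos : 0 < volume (U ∩ T.interior) :=
    (hUo.inter (isOpen_simplex_interior T)).measure_pos volume hne
  have hae : ∀ᵐ y ∂volume.restrict (U ∩ T.interior), ‖D.A y‖ ≤ M :=
    ae_restrict_of_ae_restrict_of_subset (Set.inter_subset_right.trans
      (T.interior_subset_closedInterior.trans (Triangulation.closedInterior_subset_patch T)))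
      (ae_norm_coefficient_le hD hT)
  have hmem := ae_restrict_mem (μ := volume)
    (hUo.inter (isOpen_simplex_interior T)).measurableSet
  have hfalse : ∀ᵐ y ∂volume.restrict (U ∩ T.interior), False := by
    filter_upwards [hae, hmem] with y hy hyU
    exact absurd (hU hyU.1) (not_lt.2 hy)
  rw [ae_iff] at hfalse
  simp at hfalse
  exact hpos.ne' hfalse

theorem norm_outwardNormal_le (T : Elem d) (i : Fin (d + 1)) : ‖outwardNormal T i‖ ≤ 1 := by
  rw [outwardNormal, norm_smul, ← dist_eq_norm, dist_comm, norm_inv, Affine.Simplex.height]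
  rw [Real.norm_of_nonneg dist_nonneg]
  exact inv_mul_le_one

end Coefficient

/-! ### Residuals -/

section Residual
variable {d : ℕ}

/-- The derivative of a field of symmetric matrices is symmetric. -/
theorem inner_fderiv_symm {A : E d → (E d →L[ℝ] E d)} {Ω : Set (E d)} (hΩ : IsOpen Ω)
    (hA : ∀ x ∈ Ω, ∀ ξ η : E d, inner ℝ (A x ξ) η = inner ℝ ξ (A x η)) {x : E d} (hx : x ∈ Ω)
    (hd : DifferentiableAt ℝ A x) (e ξ η : E d) :
    inner ℝ (fderiv ℝ A x e ξ) η = inner ℝ ξ (fderiv ℝ A x e η) := by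
  let l : (E d →L[ℝ] E d) →L[ℝ] ℝ :=
    (innerSL ℝ η).comp (ContinuousLinearMap.apply ℝ (E d) ξ) -
      (innerSL ℝ ξ).comp (ContinuousLinearMap.apply ℝ (E d) η)
  have hl : ∀ B, l B = inner ℝ (B ξ) η - inner ℝ ξ (B η) := fun B => by
    simp [l, real_inner_comm]
  have h0 : (l ∘ A) =ᶠ[𝓝 x] fun _ => (0 : ℝ) := by
    filter_upwards [hΩ.mem_nhds hx] with y hy
    rw [Function.comp_apply, hl, hA y hy, sub_self]
  have h1 := (l.hasFDerivAt.comp x hd.hasFDerivAt).fderiv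
  rw [h0.fderiv_eq, fderiv_fun_const] at h1
  have h2 : l (fderiv ℝ A x e) = 0 := by
    have := congrArg (fun L : E d →L[ℝ] ℝ => L e) h1
    simpa using this.symm
  rw [hl] at h2
  linarith

theorem differentiableAt_flux {A : E d → (E d →L[ℝ] E d)} {x : E d} (hd : DifferentiableAt ℝ A x)
    (p : MvPolynomial (Fin d) ℝ) :
    DifferentiableAt ℝ (fun y => A y (gradient (polyFun p) y)) x :=
  hd.clm_apply (hasFDerivAt_gradient_polyFun p x).1

theorem divergence_flux_sub {A : E d → (E d →L[ℝ] E d)} {x : E d} (hd : DifferentiableAt ℝ A x)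
    (p q : MvPolynomial (Fin d) ℝ) :
    divergence (fun y => A y (gradient (polyFun p) y)) x -
      divergence (fun y => A y (gradient (polyFun q) y)) x =
    divergence (fun y => A y (gradient (polyFun (p - q)) y)) x := by
  have h : (fun y => A y (gradient (polyFun (p - q)) y)) = fun y =>
      A y (gradient (polyFun p) y) - A y (gradient (polyFun q) y) := by
    ext1 y
    rw [gradient_polyFun_sub, map_sub]
  rw [h]
  unfold divergence
  rw [fderiv_fun_sub (differentiableAt_flux hd p) (differentiableAt_flux hd q),
    ← Finset.sum_sub_distrib]
  rfl

/-- Product rule `div (A ∇p) = div A · ∇p + A : ∇²p` for symmetric `A`. -/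
theorem abs_divergence_flux_le {A : E d → (E d →L[ℝ] E d)} {Ω : Set (E d)} (hΩ : IsOpen Ω)
    (hA : ∀ x ∈ Ω, ∀ ξ η : E d, inner ℝ (A x ξ) η = inner ℝ ξ (A x η)) {x : E d} (hx : x ∈ Ω)
    (hd : DifferentiableAt ℝ A x) (p : MvPolynomial (Fin d) ℝ) {m : ℝ}
    (hm : ∀ i k, |polyFun (MvPolynomial.pderiv k (MvPolynomial.pderiv i p)) x| ≤ m) :
    |divergence (fun y => A y (gradient (polyFun p) y)) x| ≤
      ‖matDiv A x‖ * ‖gradient (polyFun p) x‖ + ‖A x‖ * (d * (d * m)) := by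
  set e : Fin d → E d := fun i => EuclideanSpace.single i 1
  have hp := hasFDerivAt_gradient_polyFun p x
  have hterm : ∀ i, fderiv ℝ (fun y => A y (gradient (polyFun p) y)) x (e i) i =
      inner ℝ (fderiv ℝ A x (e i) (e i)) (gradient (polyFun p) x) +
        A x (fderiv ℝ (gradient (polyFun p)) x (e i)) i := by
    intro i
    rw [fderiv_clm_apply hd hp.1, _root_.add_apply, ContinuousLinearMap.comp_apply,
      ContinuousLinearMap.flip_apply, inner_fderiv_symm hΩ hA hx hd,
      EuclideanSpace.inner_single_left]
    simp [add_comm]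
  have hdiv : divergence (fun y => A y (gradient (polyFun p) y)) x =
      inner ℝ (matDiv A x) (gradient (polyFun p) x) +
        ∑ i, A x (fderiv ℝ (gradient (polyFun p)) x (e i)) i := by
    rw [divergence, matDiv, sum_inner, ← Finset.sum_add_distrib]
    exact Finset.sum_congr rfl fun i _ => hterm i
  have hsecond : ∀ i, |A x (fderiv ℝ (gradient (polyFun p)) x (e i)) i| ≤ ‖A x‖ * (d * m) := by
    intro i
    refine (abs_coord_le_norm _ i).trans (((A x).le_opNorm _).trans ?_)
    gcongr
    refine (norm_le_sum_abs _).trans ?_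
    calc ∑ k, |fderiv ℝ (gradient (polyFun p)) x (e i) k| ≤ ∑ _k : Fin d, m := by
          refine Finset.sum_le_sum fun k _ => ?_
          rw [hp.2, fderiv_polyFun]
          simpa [e, Pi.single_apply] using hm k i
      _ = d * m := by simp
  rw [hdiv]
  refine (abs_add_le _ _).trans (add_le_add (abs_real_inner_le_norm _ _) ?_)
  calc |∑ i, A x (fderiv ℝ (gradient (polyFun p)) x (e i)) i|
      ≤ ∑ i, |A x (fderiv ℝ (gradient (polyFun p)) x (e i)) i| := Finset.abs_sum_le_sum_abs _ _
    _ ≤ ∑ _i : Fin d, ‖A x‖ * (d * m) := Finset.sum_le_sum fun i _ => hsecond i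
    _ = ‖A x‖ * (d * (d * m)) := by simp; ring

/-- Rademacher's theorem for the coefficient matrix. -/
theorem ae_differentiableAt_coefficient {Ω : Set (E d)} (hΩ : IsOpen Ω) {D : ProblemData d}
    (hD : D.Admissible Ω) : ∀ᵐ x ∂volume.restrict Ω, x ∈ Ω ∧ DifferentiableAt ℝ D.A x := by
  obtain ⟨L, hL⟩ := hD.lipschitz
  rw [ae_restrict_iff' hΩ.measurableSet]
  filter_upwards [hL.ae_differentiableWithinAt_of_mem (μ := volume)] with x hx hxΩ
  exact ⟨hxΩ, (hx hxΩ).differentiableAt (hΩ.mem_nhds hxΩ)⟩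

theorem ae_norm_matDiv_le [NeZero d] {Ω : Set (E d)} (hΩ : IsOpen Ω) {𝒯 : Triangulation d Ω}
    {D : ProblemData d} (hD : D.Admissible Ω) {T : Elem d} (hT : T ∈ 𝒯.elems) :
    ∀ᵐ x ∂volume.restrict T.closedInterior,
      ‖matDiv D.A x‖ ≤ (eLpNorm (matDiv D.A) ⊤ (volume.restrict T.closedInterior)).toReal := by
  obtain ⟨L, hL⟩ := hD.lipschitz
  refine ae_norm_le_toReal_eLpNorm_top (eLpNorm_top_lt_top (M := ∑ _i : Fin d, (L : ℝ))
    (Triangulation.ae_closedInterior_of_ae hT (ae_restrict_of_forall_mem hΩ.measurableSet ?_)))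
  intro x hx
  refine (norm_sum_le _ _).trans (Finset.sum_le_sum fun i _ => ?_)
  have h1 := norm_fderiv_le_of_lipschitzOn ℝ (hΩ.mem_nhds hx) hL
  have h2 := (fderiv ℝ D.A x).le_opNorm (EuclideanSpace.single i 1)
  have h3 := (fderiv ℝ D.A x (EuclideanSpace.single i 1)).le_opNorm (EuclideanSpace.single i 1)
  simp only [PiLp.norm_single, norm_one, mul_one] at h2 h3
  exact h3.trans (h2.trans h1)

/-- A Lipschitz constant on a nondegenerate interval bounds the derivative at its end points
too. -/
theorem abs_deriv_le_of_lipschitzOnWith_Icc {f : ℝ → ℝ} (hf : ContDiff ℝ ∞ f) {a b : ℝ}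
    (hab : a < b) {B : ℝ≥0} (hB : LipschitzOnWith B f (Set.Icc a b)) {s : ℝ}
    (hs : s ∈ Set.Icc a b) : |deriv f s| ≤ B := by
  have hcl : IsClosed {s | |deriv f s| ≤ B} :=
    isClosed_le (hf.continuous_deriv (by simp)).abs continuous_const
  have hsub : Set.Ioo a b ⊆ {s | |deriv f s| ≤ B} := fun t ht =>
    norm_deriv_le_of_lipschitzOn (Icc_mem_nhds ht.1 ht.2) hB
  have h := hcl.closure_subset_iff.2 hsub
  rw [closure_Ioo hab.ne] at h
  exact h hs

end Residual

/-! ### Differences of indicators -/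

namespace Triangulation
variable {d : ℕ} [NeZero d] {Ω : Set (E d)} {𝒯 : Triangulation d Ω}

/-- Minkowski's inequality for the indicators, given pointwise bounds `G` of the residual difference
and `J` of the jump differences. -/
theorem indicator_le_add (hΩ : IsOpen Ω) (A : E d → (E d →L[ℝ] E d)) {r r' G : E d → ℝ}
    {v w : Piecewise d} {T : Elem d} {J : ℝ}
    (hG : Continuous G) (hr : ∀ᵐ x ∂volume.restrict T.closedInterior, |r x - r' x| ≤ G x)
    (hJ : ∀ i, ∀ T' ∈ 𝒯.neighbors T i, ∀ x ∈ (T.faceOpposite i).closedInterior ∩ Ω,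
      |(inner ℝ (A x (gradient (polyFun (v T')) x)) (outwardNormal T i)
          - inner ℝ (A x (gradient (polyFun (v T)) x)) (outwardNormal T i)) -
        (inner ℝ (A x (gradient (polyFun (w T')) x)) (outwardNormal T i)
          - inner ℝ (A x (gradient (polyFun (w T)) x)) (outwardNormal T i))| ≤ J) :
    𝒯.indicator A r v T ≤ 𝒯.indicator A r' w T +
      (ENNReal.ofReal (meshSize T) ^ 2 *
          eLpNorm G 2 (volume.restrict T.closedInterior) ^ 2
        + ENNReal.ofReal (meshSize T) * ∑ i, ∑ _T' ∈ 𝒯.neighbors T i,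
          ENNReal.ofReal J ^ 2 *
            (μHE[d - 1] : Measure (E d)) ((T.faceOpposite i).closedInterior ∩ Ω)) ^
              (1 / 2 : ℝ) := by
  have habs : ∀ {a b c : ℝ}, |a - b| ≤ c → ‖a‖ₑ ≤ ‖b‖ₑ + ENNReal.ofReal c := by
    intro a b c h
    calc ‖a‖ₑ = ‖b + (a - b)‖ₑ := by rw [add_sub_cancel]
      _ ≤ ‖b‖ₑ + ‖a - b‖ₑ := enorm_add_le _ _
      _ ≤ ‖b‖ₑ + ENNReal.ofReal c := by
        gcongr
        rw [Real.enorm_eq_ofReal_abs]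
        exact ENNReal.ofReal_le_ofReal h
  have hres : eLpNorm r 2 (volume.restrict T.closedInterior) ≤
      eLpNorm r' 2 (volume.restrict T.closedInterior) +
        eLpNorm G 2 (volume.restrict T.closedInterior) := by
    simp only [eLpNorm_two_eq]
    refine lintegral_sq_rpow_le_add hG.enorm.measurable.aemeasurable ?_
    filter_upwards [hr] with x hx
    refine (habs hx).trans ?_
    gcongr
    rw [Real.enorm_eq_ofReal_abs]
    exact ENNReal.ofReal_le_ofReal (le_abs_self _)
  have hsq : ∀ x : ℝ≥0∞, (x ^ (1 / 2 : ℝ)) ^ 2 = x := by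
    intro x
    rw [← ENNReal.rpow_natCast, ← ENNReal.rpow_mul]
    norm_num
  have key := sqrt_weighted_sum_le_add (Finset.univ.sigma fun i => 𝒯.neighbors T i)
    (ENNReal.ofReal (meshSize T)) (ENNReal.ofReal (meshSize T)) _ _ _
    (fun S => ∫⁻ x in (T.faceOpposite S.1).closedInterior ∩ Ω,
      ‖inner ℝ (A x (gradient (polyFun (v S.2)) x)) (outwardNormal T S.1)
        - inner ℝ (A x (gradient (polyFun (v T)) x)) (outwardNormal T S.1)‖ₑ ^ 2 ∂μHE[d - 1])
    (fun S => ∫⁻ x in (T.faceOpposite S.1).closedInterior ∩ Ω,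
      ‖inner ℝ (A x (gradient (polyFun (w S.2)) x)) (outwardNormal T S.1)
        - inner ℝ (A x (gradient (polyFun (w T)) x)) (outwardNormal T S.1)‖ₑ ^ 2 ∂μHE[d - 1])
    (fun S => (∫⁻ _x in (T.faceOpposite S.1).closedInterior ∩ Ω,
      ENNReal.ofReal J ^ 2 ∂μHE[d - 1]) ^ (1 / 2 : ℝ)) hres (by
        rintro ⟨i, T'⟩ hS
        have hT' : T' ∈ 𝒯.neighbors T i := by simpa using hS
        refine lintegral_sq_rpow_le_add aemeasurable_const ?_
        refine ae_restrict_of_forall_mem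
          ((T.faceOpposite i).isClosed_closedInterior.measurableSet.inter hΩ.measurableSet) ?_
        exact fun x hx => habs (hJ i T' hT' x hx))
  simp only [hsq, Finset.sum_sigma, setLIntegral_const] at key
  exact key

end Triangulation

/-! ### The local Lipschitz estimate -/

theorem eLpNorm_pderiv_le {d : ℕ} (S : Elem d) (q : MvPolynomial (Fin d) ℝ) (i : Fin d) :
    (eLpNorm (polyFun (MvPolynomial.pderiv i q)) 2 (volume.restrict S.closedInterior)).toReal ≤
      (eLpNorm (gradient (polyFun q)) 2 (volume.restrict S.closedInterior)).toReal := by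
  have hfin := (memLp_two_of_continuous S.isCompact_closedInterior
    (continuous_gradient_polyFun q)).2
  refine ENNReal.toReal_mono hfin.ne (eLpNorm_mono fun x => ?_)
  rw [← gradient_polyFun_coord]
  exact abs_coord_le_norm _ i

/-- Inverse estimates for the gradient and the second derivatives of a polynomial. -/
theorem exists_gradient_inverse_estimate (d : ℕ) [NeZero d] (n : ℕ) {s : ℝ} (hs : 0 < s) :
    ∃ C : ℝ, 0 < C ∧ ∀ S : Elem d, Metric.diam S.closedInterior ≤ s * meshSize S →
    ∀ q : MvPolynomial (Fin d) ℝ, q.totalDegree ≤ n → ∀ x ∈ S.closedInterior,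
      ‖gradient (polyFun q) x‖ * √(volume.real S.closedInterior) ≤
        C * (eLpNorm (gradient (polyFun q)) 2 (volume.restrict S.closedInterior)).toReal ∧
      ∀ i k, meshSize S * |polyFun (MvPolynomial.pderiv k (MvPolynomial.pderiv i q)) x| *
        √(volume.real S.closedInterior) ≤
          C * (eLpNorm (gradient (polyFun q)) 2 (volume.restrict S.closedInterior)).toReal := by
  obtain ⟨C, hC, hCS⟩ := exists_inverse_estimate d n hs
  have hd : (1 : ℝ) ≤ d := by exact_mod_cast NeZero.pos d
  refine ⟨d * C, by positivity, fun S hS q hq x hx => ?_⟩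
  set N := (eLpNorm (gradient (polyFun q)) 2 (volume.restrict S.closedInterior)).toReal
  have hN : 0 ≤ N := ENNReal.toReal_nonneg
  have hi := fun i => hCS S hS (MvPolynomial.pderiv i q) ((totalDegree_pderiv_le i q).trans hq) x hx
  have hNi : ∀ i, C * (eLpNorm (polyFun (MvPolynomial.pderiv i q)) 2
      (volume.restrict S.closedInterior)).toReal ≤ C * N := fun i =>
    mul_le_mul_of_nonneg_left (eLpNorm_pderiv_le S q i) hC.le
  constructor
  · calc ‖gradient (polyFun q) x‖ * √(volume.real S.closedInterior)
        ≤ (∑ i, |gradient (polyFun q) x i|) * √(volume.real S.closedInterior) := by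
          gcongr
          exact norm_le_sum_abs _
      _ = ∑ i, |polyFun (MvPolynomial.pderiv i q) x| * √(volume.real S.closedInterior) := by
          simp only [gradient_polyFun_coord, Finset.sum_mul]
      _ ≤ ∑ _i : Fin d, C * N := Finset.sum_le_sum fun i _ => (hi i).1.trans (hNi i)
      _ = d * C * N := by simp; ring
  · intro i k
    refine ((hi i).2 k).trans ((hNi i).trans ?_)
    rw [mul_assoc]
    exact le_mul_of_one_le_left (by positivity) hd

/-- The `L²` norm of the pointwise bound of the residual difference. -/
theorem eLpNorm_residual_bound_le {d : ℕ} (T : Elem d) (q : MvPolynomial (Fin d) ℝ) {a m B P : ℝ}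
    (ha : 0 ≤ a) (hm : 0 ≤ m) (hB : 0 ≤ B)
    (hgrad : (eLpNorm (gradient (polyFun q)) 2 (volume.restrict T.closedInterior)).toReal ≤ P)
    (hval : (eLpNorm (polyFun q) 2 (volume.restrict T.closedInterior)).toReal ≤ P) :
    eLpNorm (fun x => a * ‖gradient (polyFun q) x‖ + m + B * |polyFun q x|) 2
      (volume.restrict T.closedInterior) ≤
      ENNReal.ofReal (a * P + m * √(volume.real T.closedInterior) + B * P) := by
  have hP : 0 ≤ P := ENNReal.toReal_nonneg.trans hgrad
  set μ := volume.restrict T.closedInterior with hμ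
  have hcg := continuous_gradient_polyFun q
  have hcq := continuous_polyFun q
  have hg : eLpNorm (fun x => a * ‖gradient (polyFun q) x‖) 2 μ ≤ ENNReal.ofReal (a * P) := by
    have h1 : (fun x => a * ‖gradient (polyFun q) x‖) = a • fun x => ‖gradient (polyFun q) x‖ := rfl
    rw [h1, eLpNorm_const_smul, eLpNorm_norm, Real.enorm_of_nonneg ha, ENNReal.ofReal_mul ha]
    gcongr
    rw [← ENNReal.ofReal_toReal (memLp_two_of_continuous T.isCompact_closedInterior hcg).2.ne]
    exact ENNReal.ofReal_le_ofReal hgrad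
  have hv : eLpNorm (fun x => B * |polyFun q x|) 2 μ ≤ ENNReal.ofReal (B * P) := by
    have h1 : (fun x => B * |polyFun q x|) = B • fun x => ‖polyFun q x‖ := rfl
    rw [h1, eLpNorm_const_smul, eLpNorm_norm, Real.enorm_of_nonneg hB, ENNReal.ofReal_mul hB]
    gcongr
    rw [← ENNReal.ofReal_toReal (memLp_polyFun T.isCompact_closedInterior q).2.ne]
    exact ENNReal.ofReal_le_ofReal hval
  have hc : eLpNorm (fun _ : E d => m) 2 μ =
      ENNReal.ofReal (m * √(volume.real T.closedInterior)) := by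
    rw [eLpNorm_two_eq, lintegral_const, hμ, Measure.restrict_apply_univ,
      ENNReal.mul_rpow_of_nonneg _ _ (by norm_num), Real.enorm_of_nonneg hm, ENNReal.ofReal_mul hm,
      ← ENNReal.rpow_natCast, ← ENNReal.rpow_mul, Real.sqrt_eq_rpow,
      ← ENNReal.ofReal_rpow_of_nonneg measureReal_nonneg (by norm_num), Measure.real,
      ENNReal.ofReal_toReal (volume_closedInterior_lt_top T).ne]
    norm_num
  have hsplit : (fun x => a * ‖gradient (polyFun q) x‖ + m + B * |polyFun q x|) =
      ((fun x => a * ‖gradient (polyFun q) x‖) + fun _ => m) + fun x => B * |polyFun q x| := rfl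
  rw [hsplit, ENNReal.ofReal_add (by positivity) (by positivity),
    ENNReal.ofReal_add (by positivity) (by positivity)]
  refine (eLpNorm_add_le (by fun_prop) (by fun_prop) one_le_two).trans (add_le_add ?_ hv)
  exact (eLpNorm_add_le (by fun_prop) (by fun_prop) one_le_two).trans (add_le_add hg hc.le)

namespace Triangulation
variable {d : ℕ} [NeZero d] {Ω : Set (E d)} {𝒯 : Triangulation d Ω}

theorem euclideanHausdorffMeasure_face_le {s : ℝ} (hs : 0 < s) {T : Elem d}
    (hT : Metric.diam T.closedInterior ≤ s * meshSize T) (i : Fin (d + 1)) (Ω : Set (E d)) :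
    (μHE[d - 1] : Measure (E d)) ((T.faceOpposite i).closedInterior ∩ Ω) ≤
      ENNReal.ofReal ((((d - 1 : ℕ) : ℝ) * s) ^ (d - 1) * volume.real (refSimplex (d - 1)) *
        meshSize T ^ (d - 1)) := by
  have hh := meshSize_pos T
  refine (measure_mono Set.inter_subset_left).trans
    ((euclideanHausdorffMeasure_closedInterior_le _ (D := s * meshSize T) (by positivity) ?_).trans
      (ENNReal.ofReal_le_ofReal (le_of_eq ?_)))
  · intro j k
    have hsub := T.closedInterior_faceOpposite_subset_closedInterior (i := i)
    exact (dist_le_diam T (hsub ((T.faceOpposite i).point_mem_closedInterior j))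
      (hsub ((T.faceOpposite i).point_mem_closedInterior k))).trans hT
  · rw [← mul_assoc, mul_pow _ (meshSize T)]
    ring

/-- Pointwise bound of the jump on a face by the local norms on the two adjacent elements. -/
theorem abs_jump_le (hΩ : IsOpen Ω) {D : ProblemData d} (hD : D.Admissible Ω) {T : Elem d}
    (hT : T ∈ 𝒯.elems) {i : Fin (d + 1)} {x : E d} (hx : x ∈ T.closedInterior) (hxΩ : x ∈ Ω)
    (a b a' b' : E d) {m : ℝ} (ha : ‖a - a'‖ ≤ m) (hb : ‖b - b'‖ ≤ m) :
    |(inner ℝ (D.A x a) (outwardNormal T i) - inner ℝ (D.A x b) (outwardNormal T i)) -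
      (inner ℝ (D.A x a') (outwardNormal T i) - inner ℝ (D.A x b') (outwardNormal T i))| ≤
      (eLpNorm D.A ⊤ (volume.restrict (𝒯.patch T))).toReal * (2 * m) := by
  have hA := norm_coefficient_le hΩ hD hT hx hxΩ
  have heq : (inner ℝ (D.A x a) (outwardNormal T i) - inner ℝ (D.A x b) (outwardNormal T i)) -
      (inner ℝ (D.A x a') (outwardNormal T i) - inner ℝ (D.A x b') (outwardNormal T i)) =
      inner ℝ (D.A x ((a - a') - (b - b'))) (outwardNormal T i) := by
    simp only [map_sub, inner_sub_left]
    ring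
  rw [heq]
  have hm : 0 ≤ m := (norm_nonneg _).trans ha
  calc |inner ℝ (D.A x ((a - a') - (b - b'))) (outwardNormal T i)|
      ≤ ‖D.A x ((a - a') - (b - b'))‖ * ‖outwardNormal T i‖ := abs_real_inner_le_norm _ _
    _ ≤ ‖D.A x ((a - a') - (b - b'))‖ * 1 := by
        gcongr
        exact norm_outwardNormal_le T i
    _ ≤ ‖D.A x‖ * ‖(a - a') - (b - b')‖ := by
        rw [mul_one]
        exact (D.A x).le_opNorm _
    _ ≤ _ := by
        gcongr
        exact (norm_sub_le _ _).trans (by linarith)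

/-- `h_T ‖div A‖`, `‖A‖` and `h_T B` are at most `η_𝒯(D, T)`. -/
theorem le_dataEstimator (A : E d → (E d →L[ℝ] E d)) (B : ℝ) (T : Elem d) :
    meshSize T * (eLpNorm (matDiv A) ⊤ (volume.restrict T.closedInterior)).toReal ≤
        𝒯.dataEstimator A B T ∧
      (eLpNorm A ⊤ (volume.restrict (𝒯.patch T))).toReal ≤ 𝒯.dataEstimator A B T ∧
      meshSize T * B ≤ 𝒯.dataEstimator A B T := by
  have hh := meshSize_pos T
  have hh' : meshSize T ^ 2 * (meshSize T)⁻¹ ^ 2 = 1 := by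
    rw [← mul_pow, mul_inv_cancel₀ hh.ne', one_pow]
  unfold dataEstimator
  set a := (eLpNorm (matDiv A) ⊤ (volume.restrict T.closedInterior)).toReal
  set m := (eLpNorm A ⊤ (volume.restrict (𝒯.patch T))).toReal
  have h1 : meshSize T ^ 2 * (a ^ 2 + (meshSize T)⁻¹ ^ 2 * m ^ 2 + B ^ 2) =
      (meshSize T * a) ^ 2 + m ^ 2 + (meshSize T * B) ^ 2 := by
    linear_combination m ^ 2 * hh'
  rw [h1]
  refine ⟨Real.le_sqrt_of_sq_le ?_, Real.le_sqrt_of_sq_le ?_, Real.le_sqrt_of_sq_le ?_⟩ <;>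
    nlinarith [sq_nonneg (meshSize T * a), sq_nonneg m, sq_nonneg (meshSize T * B)]

/-- The local Lipschitz estimate for two indicators whose residuals differ at most by the flux
divergence of `v - w` and `B |v - w|`. -/
theorem exists_indicator_absDiffLE (hd : 2 ≤ d) (n : ℕ) {s : ℝ} (hs : 0 < s) :
    ∃ Λ : ℝ, 0 < Λ ∧ ∀ {Ω : Set (E d)}, IsOpen Ω → ∀ {𝒯 : Triangulation d Ω}, 𝒯.ShapeRegular s →
    ∀ {D : ProblemData d}, D.Admissible Ω → ∀ {T : Elem d}, T ∈ 𝒯.elems →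
    ∀ {v w : Piecewise d}, (∀ S ∈ 𝒯.elems, ((v - w) S).totalDegree ≤ n) →
    ∀ {B : ℝ}, 0 ≤ B → ∀ {r r' : E d → ℝ},
    (∀ᵐ x ∂volume.restrict T.closedInterior, |r x - r' x| ≤
      |divergence (fun y => D.A y (gradient (polyFun ((v - w) T)) y)) x| +
        B * |polyFun ((v - w) T) x|) →
    AbsDiffLE (𝒯.indicator D.A r v T) (𝒯.indicator D.A r' w T)
      (Λ * 𝒯.dataEstimator D.A B T * 𝒯.patchNorm (v - w) T) := by
  obtain ⟨C, hC, hinv⟩ := exists_gradient_inverse_estimate d n hs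
  have hd0 : (0 : ℝ) < d := by exact_mod_cast NeZero.pos d
  set c := neighborConst d s
  have hc : 0 < c := neighborConst_pos d hs
  -- the bounds of the number of neighbours and of the measure of a face
  set N := c ^ d * ((s + s * c) ^ d * volume.real (Metric.ball (0 : E d) 1))
  have hN : 0 ≤ N := by positivity
  set CF := (((d - 1 : ℕ) : ℝ) * s) ^ (d - 1) * volume.real (refSimplex (d - 1))
  have hCF : 0 ≤ CF := by positivity
  set CJ := 2 * ((1 + √(c ^ d)) * C)
  have hCJ : 0 ≤ CJ := by positivity
  set CR := 2 + d * (d * C)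
  have hCR : 0 < CR := by positivity
  set CE := (d + 1 : ℝ) * N * (CJ ^ 2 * CF)
  have hCE : 0 ≤ CE := by positivity
  refine ⟨√(CR ^ 2 + CE), Real.sqrt_pos.2 (by positivity), ?_⟩
  intro Ω hΩ 𝒯 hreg D hD T hT v w hdeg B hB r r' hr
  set P := 𝒯.patchNorm (v - w) T
  have hP : 0 ≤ P := patchNorm_nonneg _ _
  set η := 𝒯.dataEstimator D.A B T
  have hη : 0 ≤ η := Real.sqrt_nonneg _
  obtain ⟨hη1, hη2, hη3⟩ := 𝒯.le_dataEstimator D.A B T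
  set M₁ := (eLpNorm (matDiv D.A) ⊤ (volume.restrict T.closedInterior)).toReal
  have hM₁ : 0 ≤ M₁ := ENNReal.toReal_nonneg
  set M₂ := (eLpNorm D.A ⊤ (volume.restrict (𝒯.patch T))).toReal with hM₂def
  have hM₂ : 0 ≤ M₂ := ENNReal.toReal_nonneg
  have hh := meshSize_pos T
  set h := meshSize T with hhdef
  set V := √(volume.real T.closedInterior) with hVdef
  have hV : 0 < V := Real.sqrt_pos.2 (volume_real_closedInterior_pos T)
  have hVsq : V ^ 2 = h ^ d := by
    rw [hVdef, Real.sq_sqrt measureReal_nonneg, hhdef, meshSize_pow]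
  -- the gradient on the two elements adjacent to a face
  have hsup : ∀ S ∈ 𝒯.elems, S.closedInterior ⊆ 𝒯.patch T → V ≤ (1 + √(c ^ d)) *
      √(volume.real S.closedInterior) → ∀ x ∈ S.closedInterior,
      ‖gradient (polyFun (v S)) x - gradient (polyFun (w S)) x‖ ≤ (1 + √(c ^ d)) * C * P / V := by
    intro S hS hSp hVS x hx
    rw [← gradient_polyFun_sub, le_div_iff₀ hV]
    have h1 := (hinv S (hreg S hS) ((v - w) S) (hdeg S hS) x hx).1
    have h2 := gradient_norm_le_patchNorm (v - w) hT hS hSp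
    calc ‖gradient (polyFun (v S - w S)) x‖ * V
        ≤ ‖gradient (polyFun (v S - w S)) x‖ *
          ((1 + √(c ^ d)) * √(volume.real S.closedInterior)) := by gcongr
      _ = (1 + √(c ^ d)) * (‖gradient (polyFun ((v - w) S)) x‖ *
          √(volume.real S.closedInterior)) := by rw [Pi.sub_apply]; ring
      _ ≤ (1 + √(c ^ d)) * (C * P) := by
          refine mul_le_mul_of_nonneg_left (h1.trans ?_) (by positivity)
          gcongr
      _ = _ := by ring
  have hJ : ∀ i, ∀ T' ∈ 𝒯.neighbors T i, ∀ x ∈ (T.faceOpposite i).closedInterior ∩ Ω,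
      |(inner ℝ (D.A x (gradient (polyFun (v T')) x)) (outwardNormal T i)
          - inner ℝ (D.A x (gradient (polyFun (v T)) x)) (outwardNormal T i)) -
        (inner ℝ (D.A x (gradient (polyFun (w T')) x)) (outwardNormal T i)
          - inner ℝ (D.A x (gradient (polyFun (w T)) x)) (outwardNormal T i))| ≤
        M₂ * (CJ * P / V) := by
    intro i T' hT' x hx
    obtain ⟨hT'e, hface⟩ := mem_neighbors.1 hT'
    have hxTT' : x ∈ T.closedInterior ∩ T'.closedInterior := by
      rw [hface]
      exact hx.1
    have hV' : V ≤ (1 + √(c ^ d)) * √(volume.real T'.closedInterior) := by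
      have h1 : volume.real T.closedInterior ≤ c ^ d * volume.real T'.closedInterior := by
        rw [← meshSize_pow, ← meshSize_pow, ← mul_pow]
        gcongr
        exact meshSize_le_neighbor hd hs hreg hT hT'
      have h2 := Real.sqrt_le_sqrt h1
      rw [Real.sqrt_mul (by positivity)] at h2
      refine h2.trans ?_
      gcongr
      linarith
    have hVT : V ≤ (1 + √(c ^ d)) * √(volume.real T.closedInterior) :=
      le_mul_of_one_le_left hV.le (by linarith [Real.sqrt_nonneg (c ^ d)])
    have := abs_jump_le hΩ hD hT (i := i) hxTT'.1 hx.2 _ _ _ _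
      (hsup T' hT'e (neighbor_subset_patch hT') hV' x hxTT'.2)
      (hsup T hT (closedInterior_subset_patch T) hVT x hxTT'.1)
    refine this.trans (le_of_eq ?_)
    rw [hM₂def]
    ring
  -- `m` bounds the second derivatives, by the inverse estimate
  set m := C * P / (h * V) with hmdef
  have hm0 : 0 ≤ m := by positivity
  have hm : ∀ x ∈ T.closedInterior, ∀ i k,
      |polyFun (MvPolynomial.pderiv k (MvPolynomial.pderiv i ((v - w) T))) x| ≤ m := by
    intro x hx i k
    rw [hmdef, le_div_iff₀ (by positivity)]
    have h1 := (hinv T (hreg T hT) ((v - w) T) (hdeg T hT) x hx).2 i k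
    have h2 := gradient_norm_le_patchNorm (v - w) hT hT (closedInterior_subset_patch T)
    calc _ = h * |polyFun (MvPolynomial.pderiv k (MvPolynomial.pderiv i ((v - w) T))) x| * V := by
          ring
      _ ≤ _ := h1
      _ ≤ C * P := by gcongr
  set G : E d → ℝ := fun x => M₁ * ‖gradient (polyFun ((v - w) T)) x‖ + M₂ * (d * (d * m)) +
    B * |polyFun ((v - w) T) x|
  have hGc : Continuous G := by
    have h1 := continuous_gradient_polyFun ((v - w) T)
    have h2 := continuous_polyFun ((v - w) T)
    fun_prop
  have hrG : ∀ᵐ x ∂volume.restrict T.closedInterior, |r x - r' x| ≤ G x := by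
    filter_upwards [hr, ae_closedInterior_of_ae hT (ae_differentiableAt_coefficient hΩ hD),
      ae_norm_matDiv_le hΩ hD hT, ae_restrict_of_ae_restrict_of_subset
        (closedInterior_subset_patch T) (ae_norm_coefficient_le hD hT),
      ae_restrict_mem T.isClosed_closedInterior.measurableSet] with x hx hxd hx1 hx2 hxT
    refine hx.trans ?_
    have := abs_divergence_flux_le hΩ hD.symm hxd.1 hxd.2 ((v - w) T) (hm x hxT)
    have h3 : ‖matDiv D.A x‖ * ‖gradient (polyFun ((v - w) T)) x‖ ≤
        M₁ * ‖gradient (polyFun ((v - w) T)) x‖ := by gcongr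
    have h4 : ‖D.A x‖ * (d * (d * m)) ≤ M₂ * (d * (d * m)) := by gcongr
    simp only [G]
    linarith
  have hGn : eLpNorm G 2 (volume.restrict T.closedInterior) ≤
      ENNReal.ofReal (M₁ * P + M₂ * (d * (d * m)) * V + B * P) :=
    eLpNorm_residual_bound_le T _ hM₁ (by positivity) hB
      (gradient_norm_le_patchNorm (v - w) hT hT (closedInterior_subset_patch T))
      (norm_le_patchNorm (v - w) hT hT (closedInterior_subset_patch T))
  have hres : h * (M₁ * P + M₂ * (d * (d * m)) * V + B * P) ≤ CR * η * P := by
    have hmV : m * V * h = C * P := by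
      rw [hmdef]
      field_simp
    calc h * (M₁ * P + M₂ * (d * (d * m)) * V + B * P)
        = (h * M₁) * P + M₂ * (d * (d * (m * V * h))) + (h * B) * P := by ring
      _ ≤ η * P + η * (d * (d * (C * P))) + η * P := by rw [hmV]; gcongr
      _ = CR * η * P := by simp only [CR]; ring
  -- the jumps
  have hjump : h * ((d + 1 : ℝ) * N * ((M₂ * (CJ * P / V)) ^ 2 * (CF * h ^ (d - 1)))) ≤
      CE * (η * P) ^ 2 := by
    have hpow : h * h ^ (d - 1) = V ^ 2 := by
      rw [hVsq, ← pow_succ', Nat.sub_add_cancel (by omega)]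
    calc h * ((d + 1 : ℝ) * N * ((M₂ * (CJ * P / V)) ^ 2 * (CF * h ^ (d - 1))))
        = (d + 1 : ℝ) * N * (CJ ^ 2 * CF) * (M₂ * P) ^ 2 * ((h * h ^ (d - 1)) / V ^ 2) := by
          field_simp
      _ = CE * (M₂ * P) ^ 2 := by rw [hpow, div_self (by positivity), mul_one]
      _ ≤ CE * (η * P) ^ 2 := by gcongr
  have hsum : ∑ i, ∑ _T' ∈ 𝒯.neighbors T i, ENNReal.ofReal (M₂ * (CJ * P / V)) ^ 2 *
      (μHE[d - 1] : Measure (E d)) ((T.faceOpposite i).closedInterior ∩ Ω) ≤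
      ENNReal.ofReal ((d + 1 : ℝ) * N * ((M₂ * (CJ * P / V)) ^ 2 * (CF * h ^ (d - 1)))) := by
    have h1 : ∀ i, ∑ _T' ∈ 𝒯.neighbors T i, ENNReal.ofReal (M₂ * (CJ * P / V)) ^ 2 *
        (μHE[d - 1] : Measure (E d)) ((T.faceOpposite i).closedInterior ∩ Ω) ≤
        ENNReal.ofReal (N * ((M₂ * (CJ * P / V)) ^ 2 * (CF * h ^ (d - 1)))) := by
      intro i
      rw [Finset.sum_const, nsmul_eq_mul, ENNReal.ofReal_mul hN,
        ENNReal.ofReal_mul (p := (M₂ * (CJ * P / V)) ^ 2) (by positivity),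
        ENNReal.ofReal_pow (by positivity)]
      gcongr
      · rw [← ENNReal.ofReal_natCast]
        exact ENNReal.ofReal_le_ofReal (card_neighbors_le hd hs hreg hT i)
      · exact euclideanHausdorffMeasure_face_le hs (hreg T hT) i Ω
    refine (Finset.sum_le_sum fun i _ => h1 i).trans (le_of_eq ?_)
    rw [Finset.sum_const, nsmul_eq_mul, ← ENNReal.ofReal_natCast,
      ← ENNReal.ofReal_mul (by positivity)]
    simp
    congr 1
    ring
  have hc2 : (ENNReal.ofReal h ^ 2 * eLpNorm G 2 (volume.restrict T.closedInterior) ^ 2 +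
      ENNReal.ofReal h * ∑ i, ∑ _T' ∈ 𝒯.neighbors T i, ENNReal.ofReal (M₂ * (CJ * P / V)) ^ 2 *
        (μHE[d - 1] : Measure (E d)) ((T.faceOpposite i).closedInterior ∩ Ω)) ^ (1 / 2 : ℝ) ≤
      ENNReal.ofReal (√(CR ^ 2 + CE) * η * P) := by
    have h1 : ENNReal.ofReal h ^ 2 * eLpNorm G 2 (volume.restrict T.closedInterior) ^ 2 ≤
        ENNReal.ofReal ((CR * η * P) ^ 2) := by
      rw [← mul_pow, ENNReal.ofReal_pow (by positivity)]
      gcongr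
      calc ENNReal.ofReal h * eLpNorm G 2 (volume.restrict T.closedInterior)
          ≤ ENNReal.ofReal h * ENNReal.ofReal (M₁ * P + M₂ * (d * (d * m)) * V + B * P) := by gcongr
        _ ≤ _ := by
          rw [← ENNReal.ofReal_mul hh.le]
          exact ENNReal.ofReal_le_ofReal hres
    have h2 : ENNReal.ofReal h * ∑ i, ∑ _T' ∈ 𝒯.neighbors T i,
        ENNReal.ofReal (M₂ * (CJ * P / V)) ^ 2 *
        (μHE[d - 1] : Measure (E d)) ((T.faceOpposite i).closedInterior ∩ Ω) ≤
        ENNReal.ofReal (CE * (η * P) ^ 2) := by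
      refine (mul_le_mul_right hsum _).trans ?_
      rw [← ENNReal.ofReal_mul hh.le]
      exact ENNReal.ofReal_le_ofReal hjump
    refine (ENNReal.rpow_le_rpow (add_le_add h1 h2) (by norm_num)).trans (le_of_eq ?_)
    rw [← ENNReal.ofReal_add (by positivity) (by positivity),
      ENNReal.ofReal_rpow_of_nonneg (by positivity) (by norm_num), ← Real.sqrt_eq_rpow,
      show (CR * η * P) ^ 2 + CE * (η * P) ^ 2 = (CR ^ 2 + CE) * (η * P) ^ 2 by ring,
      Real.sqrt_mul (by positivity), Real.sqrt_sq (by positivity), mul_assoc]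
  refine absDiffLE_of_le_add (by positivity) hc2
    (indicator_le_add hΩ D.A hGc hrG hJ) (indicator_le_add hΩ D.A hGc ?_ ?_)
  · simpa only [abs_sub_comm] using hrG
  · intro i T' hT' x hx
    rw [abs_sub_comm]
    exact hJ i T' hT' x hx

end Triangulation

/-! ### Residual differences for the primal and dual problems -/

section
variable {d : ℕ} [NeZero d] {Ω : Set (E d)} {𝒯 : Triangulation d Ω} {D : ProblemData d}

theorem ae_abs_primalResidual_sub_le (hΩ : IsOpen Ω) (hD : D.Admissible Ω) {um up : E d → ℝ}
    {B : ℝ≥0}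
    (hB : ∀ᵐ x ∂volume.restrict Ω, LipschitzOnWith B (D.b x) (Set.Icc (um x) (up x)))
    {T : Elem d} (hT : T ∈ 𝒯.elems) {v w : Piecewise d}
    (hvw : ∀ᵐ x ∂volume.restrict T.closedInterior,
      𝒯.pwFun v x ∈ Set.Icc (um x) (up x) ∧ 𝒯.pwFun w x ∈ Set.Icc (um x) (up x)) :
    ∀ᵐ x ∂volume.restrict T.closedInterior,
      |primalResidual D (v T) x - primalResidual D (w T) x| ≤
        |divergence (fun y => D.A y (gradient (polyFun ((v - w) T)) y)) x| +
          B * |polyFun ((v - w) T) x| := by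
  filter_upwards [hvw, Triangulation.ae_closedInterior_of_ae hT hB,
    Triangulation.ae_closedInterior_of_ae hT (ae_differentiableAt_coefficient hΩ hD),
    Triangulation.ae_mem_interior T] with x hx hBx hdx hxT
  rw [Triangulation.pwFun_eq v hT hxT, Triangulation.pwFun_eq w hT hxT] at hx
  have hb := hBx.dist_le_mul _ hx.1 _ hx.2
  rw [Real.dist_eq, Real.dist_eq, ← polyFun_sub] at hb
  have heq : primalResidual D (v T) x - primalResidual D (w T) x =
      divergence (fun y => D.A y (gradient (polyFun ((v - w) T)) y)) x -
        (D.b x (polyFun (v T) x) - D.b x (polyFun (w T) x)) := by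
    rw [Pi.sub_apply, ← divergence_flux_sub hdx.2, primalResidual, primalResidual]
    ring
  rw [heq]
  exact (abs_sub _ _).trans (by gcongr; exact hb)

theorem ae_abs_dualResidual_sub_le (hΩ : IsOpen Ω) (hD : D.Admissible Ω) {um up : E d → ℝ}
    {B : ℝ≥0}
    (hB : ∀ᵐ x ∂volume.restrict Ω, LipschitzOnWith B (D.b x) (Set.Icc (um x) (up x)))
    (hlt : ∀ᵐ x ∂volume.restrict Ω, um x < up x) (g : E d → ℝ) {u : E d → ℝ}
    (hu : ∀ᵐ x ∂volume.restrict Ω, um x ≤ u x ∧ u x ≤ up x)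
    {T : Elem d} (hT : T ∈ 𝒯.elems) (v w : Piecewise d) :
    ∀ᵐ x ∂volume.restrict T.closedInterior,
      |dualResidual D g u (v T) x - dualResidual D g u (w T) x| ≤
        |divergence (fun y => D.A y (gradient (polyFun ((v - w) T)) y)) x| +
          B * |polyFun ((v - w) T) x| := by
  filter_upwards [Triangulation.ae_closedInterior_of_ae hT hu,
    Triangulation.ae_closedInterior_of_ae hT hB, Triangulation.ae_closedInterior_of_ae hT hlt,
    Triangulation.ae_closedInterior_of_ae hT (ae_differentiableAt_coefficient hΩ hD)]
    with x hx hBx hltx hdx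
  have hb := abs_deriv_le_of_lipschitzOnWith_Icc (hD.smooth_b x hdx.1) hltx hBx hx
  have heq : dualResidual D g u (v T) x - dualResidual D g u (w T) x =
      divergence (fun y => D.A y (gradient (polyFun ((v - w) T)) y)) x -
        deriv (D.b x) (u x) * polyFun ((v - w) T) x := by
    rw [Pi.sub_apply, ← divergence_flux_sub hdx.2, polyFun_sub, dualResidual, dualResidual]
    ring
  rw [heq]
  refine (abs_sub _ _).trans ?_
  rw [abs_mul]
  gcongr

end

end Goafem

end

open Goafem
theorem lemma4p5 (d : ℕ) [NeZero d] (hd : d = 2 ∨ d = 3) (n : ℕ) (σ : ℝ) :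
    ∃ Λ : ℝ, 0 < Λ ∧
      ∀ (Ω : Set (E d)), IsOpen Ω →
      ∀ (𝒯₀ : Triangulation d Ω), 𝒯₀.ShapeRegular σ →
      ∀ (τ : Elem d → Fin d) (𝒯 : Triangulation d Ω), 𝒯.IsRefinement 𝒯₀ τ →
      ∀ (D : ProblemData d), D.Admissible Ω →
      ∀ (g : E d → ℝ), MemLp g 2 (volume.restrict Ω) →
      ∀ (u : E d → ℝ), IsWeakSolution Ω D u →
      ∀ (um up : E d → ℝ), MemLp um ⊤ (volume.restrict Ω) → MemLp up ⊤ (volume.restrict Ω) →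
      (∀ᵐ x ∂volume.restrict Ω, um x ≤ u x ∧ u x ≤ up x) →
      ∀ (B : ℝ≥0), (∀ᵐ x ∂volume.restrict Ω, LipschitzOnWith B (D.b x) (Set.Icc (um x) (up x))) →
      ∀ T ∈ 𝒯.elems, ∀ v ∈ 𝒯.space n, ∀ w ∈ 𝒯.space n,
        -- the primal indicator
        ((∀ᵐ x ∂volume.restrict T.closedInterior,
            𝒯.pwFun v x ∈ Set.Icc (um x) (up x) ∧ 𝒯.pwFun w x ∈ Set.Icc (um x) (up x)) →
          AbsDiffLE (𝒯.primalIndicator D v T) (𝒯.primalIndicator D w T)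
            (Λ * 𝒯.dataEstimator D.A B T * 𝒯.patchNorm (v - w) T)) ∧
        ((∀ᵐ x ∂volume.restrict Ω, um x < up x) →
          -- the approximate dual indicators
          (∀ (𝒯j : Triangulation d Ω), 𝒯j.IsRefinement 𝒯₀ τ →
            ∀ (uj : Piecewise d), 𝒯j.IsGalerkinSolution n D uj →
            (∀ᵐ x ∂volume.restrict Ω, um x ≤ 𝒯j.pwFun uj x ∧ 𝒯j.pwFun uj x ≤ up x) →
            AbsDiffLE (𝒯.dualIndicator D g (𝒯j.pwFun uj) v T)
              (𝒯.dualIndicator D g (𝒯j.pwFun uj) w T)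
              (Λ * 𝒯.dataEstimator D.A B T * 𝒯.patchNorm (v - w) T)) ∧
          -- the limiting dual indicator
          AbsDiffLE (𝒯.dualIndicator D g u v T) (𝒯.dualIndicator D g u w T)
            (Λ * 𝒯.dataEstimator D.A B T * 𝒯.patchNorm (v - w) T)) := by
  have hd2 : 2 ≤ d := by omega
  have hd0 : (0 : ℝ) < d := by exact_mod_cast NeZero.pos d
  obtain ⟨Λ, hΛ, hmain⟩ := Triangulation.exists_indicator_absDiffLE hd2 n
    (s := 12 * d * max σ 1) (by positivity)
  refine ⟨Λ, hΛ, ?_⟩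
  intro Ω hΩ 𝒯₀ hreg₀ τ 𝒯 href D hD g _ u _ um up _ _ hu B hB T hT v hv w hw
  have hreg₀' : 𝒯₀.ShapeRegular (max σ 1) := fun S hS =>
    (hreg₀ S hS).trans (mul_le_mul_of_nonneg_right (le_max_left _ _) (meshSize_pos S).le)
  have hreg := href.shapeRegular hd (le_max_of_le_right zero_le_one) hreg₀'
  have hdeg : ∀ S ∈ 𝒯.elems, ((v - w) S).totalDegree ≤ n := fun S hS =>
    (MvPolynomial.totalDegree_sub _ _).trans (max_le (hv.1 S hS) (hw.1 S hS))
  refine ⟨fun hvw => ?_, fun hlt => ⟨fun 𝒯j _ uj _ huj => ?_, ?_⟩⟩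
  · exact hmain hΩ hreg hD hT hdeg B.2 (ae_abs_primalResidual_sub_le hΩ hD hB hT hvw)
  · exact hmain hΩ hreg hD hT hdeg B.2 (ae_abs_dualResidual_sub_le hΩ hD hB hlt g huj hT v w)
  · exact hmain hΩ hreg hD hT hdeg B.2 (ae_abs_dualResidual_sub_le hΩ hD hB hlt g hu hT v w)
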